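/- Let $n\ge 1$ and let $\Omega\subset\mathbb R^n$ be a bounded domain (nonempty, open, connected) with Lipschitz boundary. For $\delta>0$ put $\Omega^\delta=\Omega\cap(\delta\mathbb Z)^n$. Two points of a lattice $(\delta\mathbb Z)^m$ are neighbours if they differ by $\pm\delta e_j$ for some $j$; $\partial\Omega^\delta$ is the set of points of $(\delta\mathbb Z)^n\setminus\Omega^\delta$ having a neighbour in $\Omega^\delta$, and $\overline\Omega^\delta=\Omega^\delta\cup\partial\Omega^\delta$. The $\delta$-discrete Laplacian on $(\delta\mathbb Z)^m$ is $\Delta_\delta u(x)=\delta^{-2}\bigl(\sum_{j=1}^m(u(x+\delta e_j)+u(x-\delta e_j))-2m\,u(x)\bigr)$, and $u$ is $\delta$-discrete harmonic on a set of lattice points if $\Delta_\delta u=0$ at each of them. Let $\lambda_1^\delta>0$ be the smallest eigenvalue of the problem $-\Delta_\delta g=\lambda g$ in $\Omega^\delta$, $g=0$ on $\partial\Omega^\delta$, and let $a_1^\delta>0$ be the positive solution of $\cosh(\delta a_1^\delta)=1+\tfrac12\delta^2\lambda_1^\delta$. Only those $\delta>0$ are considered for which $\Omega^\delta$ is nonempty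 and connected as a set of lattice points (any two of its points are joined by a chain of successive neighbours in it). Points of $(\delta\mathbb Z)^{n+1}$ are written $(x',x_{n+1})$ with $x'\in(\delta\mathbb Z)^n$. (i) There is a constant $C_\Omega>0$, depending only on $\Omega$, such that the following holds for every such $\delta$ and every $N>0$ with $N\in\delta\mathbb Z$. Let $h$ be a real function on $\overline\Omega^\delta\times([-N,N]\cap\delta\mathbb Z)$ that is $\delta$-discrete harmonic on $\Omega^\delta\times((-N,N)\cap\delta\mathbb Z)$, equals $f$ on $\partial\Omega^\delta\times([-N,N]\cap\delta\mathbb Z)$, and satisfies $|h(x',\pm N)|\le M_N$ for all $x'\in\Omega^\delta$. Then $$\max_{x'\in\overline\Omega^\delta}|h(x',0)|\le \max|f|+C_\Omega\,(M_N+\max|f|)\exp(-a_1^\delta N),$$ where $\max|f|$ is taken over $\partial\Omega^\delta\times([-N,N]\cap\delta\mathbb Z)$. (ii) For every such $\delta$: if $h$ is a real function on $\overline\Omega^\delta\times\delta\mathbb Z$ that is $\delta$-discrete harmonic on $\Omega^\delta\times\delta\mathbb Z$, if $|h(x',x_{n+1})|=o(\exp(a_1^\delta|x_{n+1}|))$ as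 $|x_{n+1}|\to\infty$, $x'\in\Omega^\delta$, and if $|h|\le B$ on $\partial\Omega^\delta\times\delta\mathbb Z$ for a constant $B$, then $|h|\le B$ on $\overline\Omega^\delta\times\delta\mathbb Z$. -/

import Mathlib

open scoped NNReal Asymptotics RealInnerProductSpace

/-- `Ω` has Lipschitz boundary: near each of its boundary points, in suitable orthonormal
coordinates, `Ω` is the set of points lying strictly above the graph of a Lipschitz function.
Here `ν` is the vertical direction, and `y - ⟪ν, y⟫ • ν` is the horizontal component of `y`. -/
def HasLipschitzBoundary {n : ℕ} (Ω : Set (EuclideanSpace ℝ (Fin n))) : Prop :=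
  ∀ p ∈ frontier Ω, ∃ ν : EuclideanSpace ℝ (Fin n), ‖ν‖ = 1 ∧
    ∃ (K : ℝ≥0) (φ : EuclideanSpace ℝ (Fin n) → ℝ), LipschitzWith K φ ∧
      ∃ r > 0, ∀ y ∈ Metric.ball p r, (y ∈ Ω ↔ φ (y - ⟪ν, y⟫ • ν) < ⟪ν, y⟫)

/-! Throughout, the point `δ x` of the lattice `(δℤ)ᵐ` is represented by its vector
`x : Fin m → ℤ` of integer coordinates. A function on a subset of the lattice is represented by
a total function; only its values on that subset are ever used. -/

/-- `x` and `y` are neighbouring points of the lattice. -/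
def LatticeNeighbor {m : ℕ} (x y : Fin m → ℤ) : Prop :=
  ∃ j : Fin m, y = x + Pi.single j 1 ∨ y = x - Pi.single j 1

/-- The `δ`-discrete Laplacian on `(δℤ)ᵐ`. -/
noncomputable def discreteLaplacian {m : ℕ} (δ : ℝ) (u : (Fin m → ℤ) → ℝ) (x : Fin m → ℤ) : ℝ :=
  (δ ^ 2)⁻¹ * (∑ j : Fin m, (u (x + Pi.single j 1) + u (x - Pi.single j 1)) - 2 * m * u x)

/-- `u` is `δ`-discrete harmonic at every point of `D`. -/
def DiscreteHarmonicOn {m : ℕ} (δ : ℝ) (u : (Fin m → ℤ) → ℝ) (D : Set (Fin m → ℤ)) : Prop :=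
  ∀ x ∈ D, discreteLaplacian δ u x = 0

/-- A discrete domain: a nonempty set of lattice points in which any two points are joined by a
chain of successively neighbouring points of the set. -/
def IsDiscreteDomain {m : ℕ} (D : Set (Fin m → ℤ)) : Prop :=
  D.Nonempty ∧ ∀ x ∈ D, ∀ y ∈ D,
    Relation.ReflTransGen (fun a b => b ∈ D ∧ LatticeNeighbor a b) x y

/-- The discrete boundary `∂D`: lattice points outside `D` with a neighbour in `D`. -/
def discreteBoundary {m : ℕ} (D : Set (Fin m → ℤ)) : Set (Fin m → ℤ) :=
  {x | x ∉ D ∧ ∃ y ∈ D, LatticeNeighbor x y}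

/-- The discrete closure `D ∪ ∂D`. -/
def discreteClosure {m : ℕ} (D : Set (Fin m → ℤ)) : Set (Fin m → ℤ) :=
  D ∪ discreteBoundary D

/-- The discretization `Ω ∩ (δℤ)ⁿ` of `Ω`. -/
def meshPoints {n : ℕ} (δ : ℝ) (Ω : Set (EuclideanSpace ℝ (Fin n))) : Set (Fin n → ℤ) :=
  {x | WithLp.toLp 2 (fun i => δ * (x i : ℝ)) ∈ Ω}

/-- `μ` is an eigenvalue of `-Δ f = μ f` in `D`, `f = 0` on `∂D`. -/
def IsDirichletEigenvalue {m : ℕ} (δ : ℝ) (D : Set (Fin m → ℤ)) (μ : ℝ) : Prop :=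
  ∃ f : (Fin m → ℤ) → ℝ, (∃ x ∈ D, f x ≠ 0) ∧ (∀ x ∈ discreteBoundary D, f x = 0) ∧
    ∀ x ∈ D, -discreteLaplacian δ f x = μ * f x

/-- The first (smallest) eigenvalue of the discrete Dirichlet problem in `D`. -/
noncomputable def firstDirichletEigenvalue {m : ℕ} (δ : ℝ) (D : Set (Fin m → ℤ)) : ℝ :=
  sInf {μ | IsDirichletEigenvalue δ D μ}

/-- The positive solution `a` of `cosh (δ a) = 1 + δ² λ₁ / 2`, where `λ₁` is the first
eigenvalue of the discrete Dirichlet problem in `D`. -/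
noncomputable def growthExponent {m : ℕ} (δ : ℝ) (D : Set (Fin m → ℤ)) : ℝ :=
  δ⁻¹ * Real.arcosh (1 + δ ^ 2 * firstDirichletEigenvalue δ D / 2)

/-- The height `x_{n+1}` of the lattice point with integer coordinates `x`. -/
def latticeHeight {n : ℕ} (δ : ℝ) (x : Fin (n + 1) → ℤ) : ℝ :=
  δ * (x (Fin.last n) : ℝ)

/-- The part `E × (δℤ)` of the lattice `(δℤ)ⁿ⁺¹`. -/
def latticeCylinder {n : ℕ} (E : Set (Fin n → ℤ)) : Set (Fin (n + 1) → ℤ) :=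
  {x | Fin.init x ∈ E}

/-- The part `E × (S ∩ δℤ)` of the lattice `(δℤ)ⁿ⁺¹`. -/
def latticeSlab {n : ℕ} (δ : ℝ) (E : Set (Fin n → ℤ)) (S : Set ℝ) : Set (Fin (n + 1) → ℤ) :=
  {x | Fin.init x ∈ E ∧ latticeHeight δ x ∈ S}

/-! Let `U` be the positive part of `|h| - B` on the mesh points, extended by zero, where `B` bounds
`|h|` on the lateral boundary. It is subharmonic on the cylinder (`excess_subharmonic`). Multiply by
`U`, sum over a horizontal section, and use the Rayleigh inequality and Cauchy–Schwarz: with `α = δ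
a₁`, the ℓ² norms `e k` of the sections satisfy `2 cosh α · e k ≤ e (k + 1) + e (k - 1)`. Comparison
with `cosh (α k)` gives decay at the rate `α` away from the ends (`sqrt_sum_sq_le_of_subharmonic`).
For a fixed mesh this already yields (ii), on letting the ends go to infinity.

In (i) the constant must not depend on `δ`, while passing between sup and ℓ² norms costs a power of
the number of mesh points. A mean value inequality at unit length, `r = ⌈1/δ⌉` lattice steps,
recovers the loss: `U x 0` is at most `C / r ^ n` times the sum of `U` over the heights `±r`
(`exists_slab_mean_value`). The number of mesh points is `O(r ^ n)`, and `cosh (α r)` is bounded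
because a cube inside `Ω` bounds the eigenvalue (`exists_rate_mul_ceil_le`). If the cylinder is
shorter than `r`, then `α L` is bounded and the maximum principle suffices.

The mean value inequality is itself a comparison, with an explicit periodic kernel `slabPoisson`:
harmonic, nonnegative, equal to `1` over the origin at both ends, and `O(r ^ (-n))` at height zero.
-/

/-! ### Neighbour sums. -/

/-- The sum of the values of `v` at the neighbours of `x`. -/
def neighborSum {n : ℕ} (v : (Fin n → ℤ) → ℝ) (x : Fin n → ℤ) : ℝ :=
  ∑ j : Fin n, (v (x + Pi.single j 1) + v (x - Pi.single j 1))

theorem neighborSum_le {n : ℕ} {v : (Fin n → ℤ) → ℝ} {c : ℝ} (hv : ∀ y, v y ≤ c)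
    (x : Fin n → ℤ) : neighborSum v x ≤ 2 * n * c := by
  have : neighborSum v x ≤ ∑ _j : Fin n, (c + c) :=
    Finset.sum_le_sum fun _ _ => add_le_add (hv _) (hv _)
  simp at this
  linarith

theorem neighborSum_nonneg {n : ℕ} {v : (Fin n → ℤ) → ℝ} (hv : ∀ y, 0 ≤ v y)
    (x : Fin n → ℤ) : 0 ≤ neighborSum v x :=
  Finset.sum_nonneg fun _ _ => add_nonneg (hv _) (hv _)

theorem neighborSum_sub {n : ℕ} (v w : (Fin n → ℤ) → ℝ) (x : Fin n → ℤ) :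
    neighborSum (fun y => v y - w y) x = neighborSum v x - neighborSum w x := by
  simp only [neighborSum, ← Finset.sum_sub_distrib]
  exact Finset.sum_congr rfl fun _ _ => by ring

theorem neighborSum_mul_const {n : ℕ} (v : (Fin n → ℤ) → ℝ) (c : ℝ) (x : Fin n → ℤ) :
    neighborSum (fun y => v y * c) x = neighborSum v x * c := by
  simp only [neighborSum, Finset.sum_mul]
  exact Finset.sum_congr rfl fun _ _ => by ring

theorem neighborSum_finset_sum {n : ℕ} {ι : Type*} (s : Finset ι) (v : ι → (Fin n → ℤ) → ℝ)
    (x : Fin n → ℤ) :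
    neighborSum (fun y => ∑ i ∈ s, v i y) x = ∑ i ∈ s, neighborSum (v i) x := by
  simp only [neighborSum, ← Finset.sum_add_distrib]
  exact Finset.sum_comm

theorem neighborSum_comp_sub {n : ℕ} (v : (Fin n → ℤ) → ℝ) (x y : Fin n → ℤ) :
    neighborSum (fun z => v (z - y)) x = neighborSum v (x - y) := by
  simp only [neighborSum]
  refine Finset.sum_congr rfl fun j _ => ?_
  congr 2 <;> abel

theorem discreteLaplacian_eq {m : ℕ} (δ : ℝ) (u : (Fin m → ℤ) → ℝ) (x : Fin m → ℤ) :
    discreteLaplacian δ u x = (δ ^ 2)⁻¹ * (neighborSum u x - 2 * m * u x) := rfl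

/-! ### Maximum principle. -/

/-- Maximum principle in the slab of heights between `-r` and `r`. -/
theorem slab_nonpos_of_subharmonic {n : ℕ} {W : (Fin n → ℤ) → ℤ → ℝ} {r : ℕ}
    (T : Finset (Fin n → ℤ))
    (hT : ∀ x k, |k| ≤ (r : ℤ) → 0 < W x k → ∃ y ∈ T, W x k ≤ W y k)
    (hcap : ∀ x k, |k| = (r : ℤ) → W x k ≤ 0)
    (hsub : ∀ x k, |k| < (r : ℤ) → 0 < W x k →
      2 * (n + 1) * W x k ≤ neighborSum (fun y => W y k) x + (W x (k + 1) + W x (k - 1)))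
    (x : Fin n → ℤ) (k : ℤ) (hk : |k| ≤ (r : ℤ)) : W x k ≤ 0 := by
  by_contra! hpos
  obtain ⟨y, hyT, hy⟩ := hT x k hk hpos
  have hne : (T ×ˢ Finset.Icc (-(r : ℤ)) r).Nonempty :=
    ⟨(y, k), by simp [hyT, abs_le.1 hk]⟩
  obtain ⟨⟨y₀, k₀⟩, hmem, hmax⟩ := Finset.exists_max_image _ (fun p => W p.1 p.2) hne
  simp only [Finset.mem_product, Finset.mem_Icc, Prod.forall] at hmem hmax
  have hW₀ : 0 < W y₀ k₀ :=
    hpos.trans_le (hy.trans (hmax y k ⟨hyT, (abs_le.1 hk).1, (abs_le.1 hk).2⟩))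
  have hle : ∀ z l, |l| ≤ (r : ℤ) → W z l ≤ W y₀ k₀ := by
    intro z l hl
    by_cases hz : 0 < W z l
    · obtain ⟨y', hy'T, hy'⟩ := hT z l hl hz
      exact hy'.trans (hmax y' l ⟨hy'T, (abs_le.1 hl).1, (abs_le.1 hl).2⟩)
    · exact (not_lt.1 hz).trans hW₀.le
  -- A positive maximum at `k₀` propagates upwards one step at a time, since all other neighbours
  -- are at most the maximum; it finally contradicts `hcap` at height `r`.
  have hup : ∀ i : ℕ, k₀ + i ≤ r → W y₀ k₀ ≤ W y₀ (k₀ + i) := by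
    intro i
    induction i with
    | zero => simp
    | succ i ih =>
      intro hi
      push_cast at hi ⊢
      have h1 := ih (by omega)
      have habs : |k₀ + i| ≤ (r : ℤ) := abs_le.2 ⟨by omega, by omega⟩
      have hlt : |k₀ + i| < (r : ℤ) :=
        lt_of_le_of_ne habs fun h => absurd (hcap y₀ _ h) (not_le.2 (hW₀.trans_le h1))
      have h2 := hsub y₀ (k₀ + i) hlt (hW₀.trans_le h1)
      have h3 := neighborSum_le (v := fun y => W y (k₀ + i)) (fun z => hle z _ habs) y₀
      have h4 := hle y₀ (k₀ + i - 1) (by rw [abs_lt] at hlt; exact abs_le.2 ⟨by omega, by omega⟩)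
      have h5 : 2 * ((n : ℝ) + 1) * W y₀ k₀ ≤ 2 * (n + 1) * W y₀ (k₀ + i) := by gcongr
      rw [show k₀ + ((i : ℤ) + 1) = k₀ + i + 1 by ring]
      linarith
  have h6 := hup (r - k₀).toNat (by omega)
  have h7 := hcap y₀ (k₀ + ((r - k₀).toNat : ℤ)) (by
    rw [show k₀ + (((r : ℤ) - k₀).toNat : ℤ) = r by omega]; simp)
  linarith

/-! ### The periodic Poisson kernel of a slab. -/

/-- A product of cosines is an eigenfunction of the neighbour sum. -/
theorem neighborSum_prod_cos {n : ℕ} (θ c : Fin n → ℝ) (x : Fin n → ℤ) :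
    neighborSum (fun y => ∏ j, Real.cos (θ j * (y j - c j))) x =
      2 * (∑ j, Real.cos (θ j)) * ∏ j, Real.cos (θ j * (x j - c j)) := by
  unfold neighborSum
  rw [Finset.mul_sum, Finset.sum_mul]
  refine Finset.sum_congr rfl fun j _ => ?_
  simp only [← Finset.mul_prod_erase Finset.univ _ (Finset.mem_univ j)]
  have e1 : ∀ i ∈ Finset.univ.erase j,
      Real.cos (θ i * (((x + Pi.single j 1 : Fin n → ℤ) i : ℝ) - c i)) = Real.cos (θ i * (x i - c i)) := by
    intro i hi
    simp [Pi.single_eq_of_ne (Finset.ne_of_mem_erase hi)]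
  have e2 : ∀ i ∈ Finset.univ.erase j,
      Real.cos (θ i * (((x - Pi.single j 1 : Fin n → ℤ) i : ℝ) - c i)) = Real.cos (θ i * (x i - c i)) := by
    intro i hi
    simp [Pi.single_eq_of_ne (Finset.ne_of_mem_erase hi)]
  rw [Finset.prod_congr rfl e1, Finset.prod_congr rfl e2]
  simp only [Pi.add_apply, Pi.sub_apply, Pi.single_eq_same, Int.cast_add, Int.cast_sub,
    Int.cast_one]
  rw [show θ j * ((x j : ℝ) + 1 - c j) = θ j * (x j - c j) + θ j by ring,
    show θ j * ((x j : ℝ) - 1 - c j) = θ j * (x j - c j) - θ j by ring, Real.cos_add, Real.cos_sub]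
  ring

theorem cosh_add_one_add_cosh_sub_one (a : ℝ) (k : ℤ) :
    Real.cosh (a * ((k + 1 : ℤ) : ℝ)) + Real.cosh (a * ((k - 1 : ℤ) : ℝ)) =
      2 * Real.cosh a * Real.cosh (a * k) := by
  push_cast
  rw [show a * ((k : ℝ) + 1) = a * k + a by ring, show a * ((k : ℝ) - 1) = a * k - a by ring,
    Real.cosh_add, Real.cosh_sub]
  ring

/-- The frequencies `π (m - r) / r`, `m = 0, …, 2 r - 1`, of `2 r`-periodic functions on `ℤ`. -/
noncomputable def slabFreq (r m : ℕ) : ℝ := Real.pi * ((m : ℝ) - r) / r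

/-- The vertical growth rate of the harmonic functions with horizontal frequencies `ξ`. -/
noncomputable def slabRate {n : ℕ} (r : ℕ) (ξ : Fin n → ℕ) : ℝ :=
  Real.arcosh (1 + ∑ j, (1 - Real.cos (slabFreq r (ξ j))))

/-- A `2 r`-periodic variant of the Poisson kernel of the slab of heights between `-r` and `r`. -/
noncomputable def slabPoisson {n : ℕ} (r : ℕ) (x : Fin n → ℤ) (k : ℤ) : ℝ :=
  ((2 * r : ℝ) ^ n)⁻¹ * ∑ ξ ∈ Fintype.piFinset (fun _ : Fin n => Finset.range (2 * r)),
    (∏ j, Real.cos (slabFreq r (ξ j) * x j)) *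
      (Real.cosh (slabRate r ξ * k) / Real.cosh (slabRate r ξ * r))

theorem one_sub_cos_sum_nonneg {n : ℕ} (r : ℕ) (ξ : Fin n → ℕ) :
    0 ≤ ∑ j, (1 - Real.cos (slabFreq r (ξ j))) :=
  Finset.sum_nonneg fun _ _ => sub_nonneg.2 (Real.cos_le_one _)

theorem cosh_slabRate {n : ℕ} (r : ℕ) (ξ : Fin n → ℕ) :
    Real.cosh (slabRate r ξ) = 1 + ∑ j, (1 - Real.cos (slabFreq r (ξ j))) :=
  Real.cosh_arcosh (by linarith [one_sub_cos_sum_nonneg r ξ])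

theorem slabRate_nonneg {n : ℕ} (r : ℕ) (ξ : Fin n → ℕ) : 0 ≤ slabRate r ξ :=
  Real.arcosh_nonneg (by linarith [one_sub_cos_sum_nonneg r ξ])

/-- Each Fourier term separates: its horizontal factor has eigenvalue `2 ∑ cos θ_j`, its vertical
factor `2 cosh (slabRate r ξ)`, and `slabRate` is chosen so that these add up to `2 (n + 1)`. -/
theorem slabPoisson_harmonic {n : ℕ} (r : ℕ) (x : Fin n → ℤ) (k : ℤ) :
    neighborSum (fun y => slabPoisson r y k) x +
      (slabPoisson r x (k + 1) + slabPoisson r x (k - 1)) = 2 * (n + 1) * slabPoisson r x k := by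
  have h1 : neighborSum (fun y => slabPoisson r y k) x = ((2 * r : ℝ) ^ n)⁻¹ *
      ∑ ξ ∈ Fintype.piFinset (fun _ : Fin n => Finset.range (2 * r)),
        (2 * (∑ j, Real.cos (slabFreq r (ξ j))) * ∏ j, Real.cos (slabFreq r (ξ j) * x j)) *
          (Real.cosh (slabRate r ξ * k) / Real.cosh (slabRate r ξ * r)) := by
    simp only [slabPoisson, mul_comm ((2 * r : ℝ) ^ n)⁻¹]
    rw [neighborSum_mul_const, neighborSum_finset_sum]
    congr 1
    refine Finset.sum_congr rfl fun ξ _ => ?_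
    rw [neighborSum_mul_const]
    have := neighborSum_prod_cos (fun j => slabFreq r (ξ j)) (fun _ => 0) x
    simp only [sub_zero] at this
    rw [this]
  rw [h1]
  simp only [slabPoisson]
  rw [← mul_add, ← mul_add, ← Finset.sum_add_distrib, ← Finset.sum_add_distrib, mul_left_comm]
  congr 1
  rw [Finset.mul_sum]
  refine Finset.sum_congr rfl fun ξ _ => ?_
  have h2 := cosh_add_one_add_cosh_sub_one (slabRate r ξ) k
  have h3 := cosh_slabRate r ξ
  simp only [Finset.sum_sub_distrib, Finset.sum_const, Finset.card_univ, Fintype.card_fin,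
    nsmul_eq_mul, mul_one] at h3
  rw [h3] at h2
  rw [← mul_add, ← add_div, h2]
  ring

/-- The sum runs over a full period. After multiplication by `2 sin (φ / 2)` it telescopes to zero;
if that factor vanishes, every term is `1`. -/
theorem sum_cos_slabFreq_nonneg {r : ℕ} (hr : 0 < r) (a : ℤ) :
    0 ≤ ∑ m ∈ Finset.range (2 * r), Real.cos (slabFreq r m * a) := by
  have hr' : (r : ℝ) ≠ 0 := by positivity
  set φ : ℝ := Real.pi * a / r with hφ
  have hφr : φ * r = a * Real.pi := by rw [hφ]; field_simp
  have hterm : ∀ m : ℕ, slabFreq r m * a = φ * (m - r) := by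
    intro m; rw [slabFreq, hφ]; field_simp
  simp only [hterm]
  by_cases hs : Real.sin (φ / 2) = 0
  · obtain ⟨l, hl⟩ := Real.sin_eq_zero_iff.1 hs
    refine Finset.sum_nonneg fun m _ => ?_
    have : φ * ((m : ℝ) - r) = ((l * (m - r) : ℤ) : ℝ) * (2 * Real.pi) := by
      push_cast
      rw [show φ = 2 * (l * Real.pi) by rw [hl]; ring]
      ring
    rw [this, Real.cos_int_mul_two_pi]
    exact zero_le_one
  · have htel := Finset.sum_range_sub (fun m : ℕ => Real.sin (φ * (m - r) - φ / 2)) (2 * r)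
    have h1 : ∀ m : ℕ, Real.sin (φ * (((m + 1 : ℕ) : ℝ) - r) - φ / 2) -
        Real.sin (φ * (m - r) - φ / 2) = 2 * Real.sin (φ / 2) * Real.cos (φ * (m - r)) := by
      intro m
      push_cast
      rw [show φ * ((m : ℝ) + 1 - r) - φ / 2 = φ * (m - r) + φ / 2 by ring, Real.sin_add,
        Real.sin_sub]
      ring
    simp only [h1] at htel
    rw [← Finset.mul_sum] at htel
    have h2 : Real.sin (φ * (((2 * r : ℕ) : ℝ) - r) - φ / 2) -
        Real.sin (φ * (((0 : ℕ) : ℝ) - r) - φ / 2) = 0 := by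
      push_cast
      rw [show φ * (2 * (r : ℝ) - r) - φ / 2 = a * Real.pi - φ / 2 by rw [← hφr]; ring,
        show φ * ((0 : ℝ) - r) - φ / 2 = -(a * Real.pi + φ / 2) by rw [← hφr]; ring,
        Real.sin_neg, Real.sin_sub, Real.sin_add, Real.sin_int_mul_pi]
      ring
    rw [h2] at htel
    rcases mul_eq_zero.1 htel with h | h
    · exact absurd (by simpa using h) hs
    · exact h.ge

/-- On the caps the quotient of hyperbolic cosines is `1`, so the sum over frequency vectors factors
over coordinates. -/
theorem slabPoisson_cap {n r : ℕ} (x : Fin n → ℤ) {k : ℤ} (hk : |k| = (r : ℤ)) :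
    slabPoisson r x k = ((2 * r : ℝ) ^ n)⁻¹ *
      ∏ j, ∑ m ∈ Finset.range (2 * r), Real.cos (slabFreq r m * x j) := by
  rw [slabPoisson, ← Finset.sum_prod_piFinset]
  congr 1
  refine Finset.sum_congr rfl fun ξ _ => ?_
  have : Real.cosh (slabRate r ξ * k) = Real.cosh (slabRate r ξ * r) := by
    rw [← Real.cosh_abs, abs_mul, abs_of_nonneg (slabRate_nonneg r ξ), ← Int.cast_abs, hk]
    simp
  rw [this, div_self (Real.cosh_pos _).ne', mul_one]

theorem slabPoisson_zero_cap {n r : ℕ} (hr : 0 < r) {k : ℤ} (hk : |k| = (r : ℤ)) :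
    slabPoisson r (0 : Fin n → ℤ) k = 1 := by
  rw [slabPoisson_cap _ hk]
  have : (2 * r : ℝ) ^ n ≠ 0 := by positivity
  simp [inv_mul_cancel₀ this]

/-- All frequencies are multiples of `π / r`. Periodicity reduces the maximum principle to a finite
box. -/
theorem slabPoisson_emod {n r : ℕ} (hr : 0 < r) (x : Fin n → ℤ) (k : ℤ) :
    slabPoisson r (fun j => x j % (2 * r : ℤ)) k = slabPoisson r x k := by
  have hr' : (r : ℝ) ≠ 0 := by positivity
  simp only [slabPoisson]
  congr 1
  refine Finset.sum_congr rfl fun ξ _ => ?_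
  congr 1
  refine Finset.prod_congr rfl fun j _ => ?_
  have h : (x j : ℝ) = ((x j % (2 * r : ℤ) : ℤ) : ℝ) + 2 * r * ((x j / (2 * r : ℤ) : ℤ) : ℝ) := by
    exact_mod_cast (Int.emod_add_mul_ediv (x j) (2 * r)).symm
  rw [h, show slabFreq r (ξ j) * (((x j % (2 * r : ℤ) : ℤ) : ℝ) +
      2 * r * ((x j / (2 * r : ℤ) : ℤ) : ℝ)) = slabFreq r (ξ j) * ((x j % (2 * r : ℤ) : ℤ) : ℝ) +
      (((ξ j - r) * (x j / (2 * r : ℤ)) : ℤ) : ℝ) * (2 * Real.pi) by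
    rw [slabFreq]; push_cast; field_simp, Real.cos_add_int_mul_two_pi]

theorem slabPoisson_nonneg {n r : ℕ} (hr : 0 < r) (x : Fin n → ℤ) {k : ℤ} (hk : |k| ≤ (r : ℤ)) :
    0 ≤ slabPoisson r x k := by
  have hneg : ∀ (y : Fin n → ℤ) (l : ℤ),
      neighborSum (fun z => -slabPoisson r z l) y = -neighborSum (fun z => slabPoisson r z l) y := by
    intro y l
    simpa using neighborSum_mul_const (fun z => slabPoisson r z l) (-1) y
  have := slab_nonpos_of_subharmonic (W := fun x k => -slabPoisson r x k) (r := r)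
    (Fintype.piFinset fun _ : Fin n => Finset.Ico 0 (2 * r : ℤ)) ?_ ?_ ?_ x k hk
  · linarith
  · intro y l _ _
    refine ⟨fun j => y j % (2 * r : ℤ), ?_, by rw [slabPoisson_emod hr]⟩
    simp only [Fintype.mem_piFinset, Finset.mem_Ico]
    exact fun j => ⟨Int.emod_nonneg _ (by omega), Int.emod_lt_of_pos _ (by omega)⟩
  · intro y l hl
    have : 0 ≤ slabPoisson r y l := by
      rw [slabPoisson_cap _ hl]
      exact mul_nonneg (by positivity) (Finset.prod_nonneg fun j _ => sum_cos_slabFreq_nonneg hr _)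
    linarith
  · intro y l _ _
    have := slabPoisson_harmonic r y l
    rw [hneg]
    linarith

/-- With `a` the rate and `z = cosh a - 1`, the bound `cosh a ≤ exp (a² / 2)` gives `a² ≥ 2 log (1 +
z) ≥ 2 z / (1 + z)`, where `z ≤ 2 n`. From below, `1 - cos θ ≥ 2 θ² / π²` bounds `z` by a sum of
squares, and Cauchy–Schwarz turns this into the square of a sum. -/
theorem slabRate_lower {n r : ℕ} (hr : 0 < r) {ξ : Fin n → ℕ} (hξ : ∀ j, ξ j < 2 * r) :
    2 / (1 + 2 * (n : ℝ)) * ∑ j, |(ξ j : ℝ) - r| ≤ slabRate r ξ * r := by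
  have hr' : (0 : ℝ) < r := by positivity
  set z := ∑ j, (1 - Real.cos (slabFreq r (ξ j))) with hz
  have hz0 : 0 ≤ z := one_sub_cos_sum_nonneg r ξ
  have hz2 : z ≤ 2 * n := by
    have : z ≤ ∑ _j : Fin n, (2 : ℝ) :=
      Finset.sum_le_sum fun j _ => by linarith [Real.neg_one_le_cos (slabFreq r (ξ j))]
    simpa [mul_comm] using this
  have hzl : 2 / (r : ℝ) ^ 2 * ∑ j, |(ξ j : ℝ) - r| ^ 2 ≤ z := by
    rw [Finset.mul_sum]
    refine Finset.sum_le_sum fun j _ => ?_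
    have hj : |(ξ j : ℝ) - r| ≤ r := by
      have h2 : (ξ j : ℝ) ≤ 2 * r := by exact_mod_cast (hξ j).le
      have h3 : (0 : ℝ) ≤ ξ j := by positivity
      exact abs_le.2 ⟨by linarith, by linarith⟩
    have hθ : |slabFreq r (ξ j)| ≤ Real.pi := by
      rw [slabFreq, abs_div, abs_mul, abs_of_pos Real.pi_pos, abs_of_pos hr', div_le_iff₀ hr']
      exact mul_le_mul_of_nonneg_left hj Real.pi_pos.le
    have := Real.cos_le_one_sub_mul_cos_sq hθ
    have he : 2 / Real.pi ^ 2 * slabFreq r (ξ j) ^ 2 = 2 / (r : ℝ) ^ 2 * |(ξ j : ℝ) - r| ^ 2 := by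
      rw [slabFreq, sq_abs]
      field_simp
    linarith
  have hcosh := Real.cosh_le_exp_half_sq (slabRate r ξ)
  rw [cosh_slabRate, ← hz] at hcosh
  have hlog : Real.log (1 + z) ≤ slabRate r ξ ^ 2 / 2 := by
    rw [← Real.log_exp (slabRate r ξ ^ 2 / 2)]
    exact Real.log_le_log (by linarith) hcosh
  have h4 := Real.one_sub_inv_le_log_of_pos (show 0 < 1 + z by linarith)
  have h5 : z / (1 + 2 * n) ≤ 1 - (1 + z)⁻¹ := by
    rw [show 1 - (1 + z)⁻¹ = z / (1 + z) by field_simp; ring]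
    gcongr
  have hcs := sq_sum_le_card_mul_sum_sq (s := Finset.univ) (f := fun j => |(ξ j : ℝ) - r|)
  simp only [Finset.card_univ, Fintype.card_fin] at hcs
  have hn : (0 : ℝ) ≤ n := by positivity
  set A := ∑ j, |(ξ j : ℝ) - r| with hA
  set B := ∑ j, |(ξ j : ℝ) - r| ^ 2 with hB
  have hB0 : 0 ≤ B := Finset.sum_nonneg fun _ _ => by positivity
  refine abs_le_of_sq_le_sq' ?_ (mul_nonneg (slabRate_nonneg r ξ) hr'.le) |>.2
  have h6 : 2 * (z / (1 + 2 * n)) ≤ slabRate r ξ ^ 2 := by linarith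
  have h7 : 2 * B ≤ z * r ^ 2 := by
    have := mul_le_mul_of_nonneg_right hzl (sq_nonneg (r : ℝ))
    rwa [show 2 / (r : ℝ) ^ 2 * B * r ^ 2 = 2 * B by field_simp] at this
  calc (2 / (1 + 2 * (n : ℝ)) * A) ^ 2 = 4 / (1 + 2 * n) ^ 2 * A ^ 2 := by
        rw [mul_pow, div_pow]; norm_num
    _ ≤ 4 / (1 + 2 * (n : ℝ)) ^ 2 * ((1 + 2 * n) * B) := by
        gcongr
        exact hcs.trans (by nlinarith)
    _ = 2 / (1 + 2 * (n : ℝ)) * (2 * B) := by field_simp; ring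
    _ ≤ 2 / (1 + 2 * (n : ℝ)) * (z * r ^ 2) := by gcongr
    _ = 2 * (z / (1 + 2 * n)) * r ^ 2 := by ring
    _ ≤ slabRate r ξ ^ 2 * r ^ 2 := by gcongr
    _ = (slabRate r ξ * r) ^ 2 := by ring

theorem summable_exp_neg_mul_abs_int {c : ℝ} (hc : 0 < c) :
    Summable fun m : ℤ => Real.exp (-(c * |(m : ℝ)|)) := by
  have h : Summable fun m : ℕ => Real.exp (-(c * (m : ℝ))) := by
    have := Real.summable_exp_nat_mul_iff.2 (neg_lt_zero.2 hc)
    refine this.congr fun m => ?_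
    congr 1; ring
  refine Summable.of_nat_of_neg ?_ ?_
  · simpa using h
  · simpa using h

theorem inv_cosh_le (x : ℝ) : (Real.cosh x)⁻¹ ≤ 2 * Real.exp (-x) := by
  rw [inv_le_iff_one_le_mul₀ (Real.cosh_pos x), Real.cosh_eq]
  have : Real.exp (-x) * Real.exp x = 1 := by rw [← Real.exp_add]; simp
  nlinarith [Real.exp_pos (-x)]

theorem cosh_le_exp {x : ℝ} (hx : 0 ≤ x) : Real.cosh x ≤ Real.exp x := by
  rw [Real.cosh_eq]
  have : Real.exp (-x) ≤ Real.exp x := Real.exp_le_exp.2 (by linarith)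
  linarith

/-- The cosines are bounded by `1`, and by `slabRate_lower` the remaining sum is dominated by a
product of `n` one-dimensional exponential sums, bounded uniformly in `r`; the prefactor supplies
the power of `r`. -/
theorem exists_slabPoisson_le (n : ℕ) :
    ∃ C : ℝ, 0 < C ∧ ∀ r : ℕ, 0 < r → ∀ x : Fin n → ℤ, slabPoisson r x 0 ≤ C / (r : ℝ) ^ n := by
  set c : ℝ := 2 / (1 + 2 * (n : ℝ)) with hc
  have hc0 : 0 < c := by positivity
  set S : ℝ := ∑' m : ℤ, Real.exp (-(c * |(m : ℝ)|)) with hS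
  have hsum := summable_exp_neg_mul_abs_int hc0
  have hS0 : 0 < S := hsum.tsum_pos (fun _ => (Real.exp_pos _).le) 0 (Real.exp_pos _)
  refine ⟨2 * S ^ n, by positivity, fun r hr x => ?_⟩
  have hr' : (0 : ℝ) < r := by positivity
  have hrow : ∑ m ∈ Finset.range (2 * r), Real.exp (-(c * |(m : ℝ) - r|)) ≤ S := by
    have hinj : Set.InjOn (fun m : ℕ => (m : ℤ) - r) (Finset.range (2 * r)) := by
      intro a _ b _ hab
      simpa using hab
    calc ∑ m ∈ Finset.range (2 * r), Real.exp (-(c * |(m : ℝ) - r|))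
        = ∑ m ∈ (Finset.range (2 * r)).image (fun m : ℕ => (m : ℤ) - r),
            Real.exp (-(c * |(m : ℝ)|)) := by
          rw [Finset.sum_image hinj]
          push_cast
          rfl
      _ ≤ S := hsum.sum_le_tsum _ fun _ _ => (Real.exp_pos _).le
  have hterm : ∀ ξ ∈ Fintype.piFinset (fun _ : Fin n => Finset.range (2 * r)),
      (∏ j, Real.cos (slabFreq r (ξ j) * x j)) *
        (Real.cosh (slabRate r ξ * (0 : ℤ)) / Real.cosh (slabRate r ξ * r)) ≤
      2 * ∏ j, Real.exp (-(c * |(ξ j : ℝ) - r|)) := by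
    intro ξ hξ
    have hξ' : ∀ j, ξ j < 2 * r := by simpa using hξ
    have hp : (∏ j, Real.cos (slabFreq r (ξ j) * x j)) ≤ 1 := by
      refine (le_abs_self _).trans ?_
      rw [Finset.abs_prod]
      exact Finset.prod_le_one (fun _ _ => abs_nonneg _) fun _ _ => Real.abs_cos_le_one _
    have h1 : Real.cosh (slabRate r ξ * (0 : ℤ)) / Real.cosh (slabRate r ξ * r) =
        (Real.cosh (slabRate r ξ * r))⁻¹ := by simp
    rw [h1, ← Real.exp_sum]
    calc _ ≤ 1 * (Real.cosh (slabRate r ξ * r))⁻¹ :=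
          mul_le_mul_of_nonneg_right hp (inv_nonneg.2 (Real.cosh_pos _).le)
      _ ≤ 2 * Real.exp (-(slabRate r ξ * r)) := by rw [one_mul]; exact inv_cosh_le _
      _ ≤ _ := by
        gcongr
        rw [Finset.sum_neg_distrib, ← Finset.mul_sum]
        exact neg_le_neg (slabRate_lower hr hξ')
  calc slabPoisson r x 0
      ≤ ((2 * r : ℝ) ^ n)⁻¹ * ∑ ξ ∈ Fintype.piFinset (fun _ : Fin n => Finset.range (2 * r)),
          2 * ∏ j, Real.exp (-(c * |(ξ j : ℝ) - r|)) :=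
        mul_le_mul_of_nonneg_left (Finset.sum_le_sum hterm) (by positivity)
    _ = ((2 * r : ℝ) ^ n)⁻¹ *
          (2 * (∑ m ∈ Finset.range (2 * r), Real.exp (-(c * |(m : ℝ) - r|))) ^ n) := by
        rw [← Finset.mul_sum,
          Finset.sum_prod_piFinset (Finset.range (2 * r))
            (fun (_ : Fin n) (m : ℕ) => Real.exp (-(c * |(m : ℝ) - r|)))]
        simp
    _ ≤ ((r : ℝ) ^ n)⁻¹ * (2 * S ^ n) := by
        gcongr
        linarith
    _ = 2 * S ^ n / (r : ℝ) ^ n := by ring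

/-! ### The mean value inequality. -/

/-- A nonnegative function that vanishes off a finite set `D` and is subharmonic on `D` satisfies
a mean value inequality in the slab of heights between `-r` and `r`. -/
theorem exists_slab_mean_value (n : ℕ) :
    ∃ C : ℝ, 0 < C ∧ ∀ (r : ℕ), 0 < r → ∀ (D : Finset (Fin n → ℤ)) (U : (Fin n → ℤ) → ℤ → ℝ),
      (∀ x k, 0 ≤ U x k) → (∀ x ∉ D, ∀ k, U x k = 0) →
      (∀ x ∈ D, ∀ k : ℤ, |k| < (r : ℤ) →
        2 * (n + 1) * U x k ≤ neighborSum (fun y => U y k) x + (U x (k + 1) + U x (k - 1))) →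
      ∀ x, U x 0 ≤ C / (r : ℝ) ^ n * ∑ y ∈ D, (U y r + U y (-r)) := by
  obtain ⟨C, hC, hP⟩ := exists_slabPoisson_le n
  refine ⟨C, hC, fun r hr D U hU0 hUD hsub x => ?_⟩
  -- The kernel equals `1` over the origin on both caps, so a single kernel carrying the sum of the
  -- two cap values majorizes `U` on each cap.
  set V : (Fin n → ℤ) → ℤ → ℝ :=
    fun z k => ∑ y ∈ D, slabPoisson r (z - y) k * (U y r + U y (-r)) with hV
  have hS0 : ∀ y, 0 ≤ U y r + U y (-r) := fun y => add_nonneg (hU0 _ _) (hU0 _ _)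
  have hV0 : ∀ z k, |k| ≤ (r : ℤ) → 0 ≤ V z k := fun z k hk =>
    Finset.sum_nonneg fun y _ => mul_nonneg (slabPoisson_nonneg hr _ hk) (hS0 y)
  have hVh : ∀ z k, neighborSum (fun y => V y k) z + (V z (k + 1) + V z (k - 1)) =
      2 * (n + 1) * V z k := by
    intro z k
    simp only [hV]
    rw [neighborSum_finset_sum, ← Finset.sum_add_distrib, ← Finset.sum_add_distrib, Finset.mul_sum]
    refine Finset.sum_congr rfl fun y _ => ?_
    rw [neighborSum_mul_const (fun z => slabPoisson r (z - y) k),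
      neighborSum_comp_sub (fun z => slabPoisson r z k), ← mul_assoc,
      ← slabPoisson_harmonic r (z - y) k]
    ring
  have hpos : ∀ z k, |k| ≤ (r : ℤ) → 0 < U z k - V z k → z ∈ D := by
    intro z k hk h
    by_contra hz
    rw [hUD z hz k] at h
    linarith [hV0 z k hk]
  have hmain := slab_nonpos_of_subharmonic (W := fun z k => U z k - V z k) (r := r) D
    (fun z k hk h => ⟨z, hpos z k hk h, le_rfl⟩) ?_ ?_ x 0 (by simp)
  · refine (sub_nonpos.1 hmain).trans ?_
    simp only [hV]
    rw [Finset.mul_sum]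
    exact Finset.sum_le_sum fun y _ => mul_le_mul_of_nonneg_right (hP r hr _) (hS0 y)
  · intro z k hk
    by_cases hz : z ∈ D
    · have h1 : slabPoisson r (z - z) k * (U z r + U z (-r)) ≤ V z k :=
        Finset.single_le_sum (f := fun y => slabPoisson r (z - y) k * (U y r + U y (-r)))
          (fun y _ => mul_nonneg (slabPoisson_nonneg hr _ hk.le) (hS0 y)) hz
      rw [sub_self, slabPoisson_zero_cap hr hk, one_mul] at h1
      have h2 : U z k ≤ U z r + U z (-r) := by
        rcases (abs_eq (by omega : (0 : ℤ) ≤ r)).1 hk with h | h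
        · rw [h]; linarith [hU0 z (-r)]
        · rw [h]; linarith [hU0 z r]
      linarith
    · rw [hUD z hz k]
      linarith [hV0 z k hk.le]
  · intro z k hk h
    have h1 := hsub z (hpos z k hk.le h) k hk
    have h2 := hVh z k
    rw [neighborSum_sub]
    linarith

/-! ### The first Dirichlet eigenvalue and its Rayleigh quotient. -/

theorem latticeNeighbor_comm {m : ℕ} {x y : Fin m → ℤ} :
    LatticeNeighbor x y ↔ LatticeNeighbor y x := by
  suffices ∀ {x y : Fin m → ℤ}, LatticeNeighbor x y → LatticeNeighbor y x from ⟨this, this⟩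
  rintro x y ⟨j, rfl | rfl⟩
  · exact ⟨j, Or.inr (by simp)⟩
  · exact ⟨j, Or.inl (by simp)⟩

theorem neighborSum_congr {n : ℕ} {v w : (Fin n → ℤ) → ℝ} {x : Fin n → ℤ}
    (h : ∀ y, LatticeNeighbor x y → v y = w y) : neighborSum v x = neighborSum w x :=
  Finset.sum_congr rfl fun j _ => by rw [h _ ⟨j, Or.inl rfl⟩, h _ ⟨j, Or.inr rfl⟩]

/-- The adjacency matrix of the lattice, restricted to `D`. -/
def neighborMatrix {n : ℕ} (D : Finset (Fin n → ℤ)) : Matrix D D ℝ :=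
  fun x y => ∑ j : Fin n, ((if (y : Fin n → ℤ) = (x : Fin n → ℤ) + Pi.single j 1 then 1 else 0) +
    (if (y : Fin n → ℤ) = (x : Fin n → ℤ) - Pi.single j 1 then 1 else 0))

theorem neighborMatrix_symm {n : ℕ} (D : Finset (Fin n → ℤ)) (x y : D) :
    neighborMatrix D y x = neighborMatrix D x y := by
  unfold neighborMatrix
  refine Finset.sum_congr rfl fun j _ => ?_
  rw [add_comm]
  congr 2
  · exact propext ⟨fun h => by rw [h]; simp, fun h => by rw [h]; simp⟩
  · exact propext ⟨fun h => by rw [h]; simp, fun h => by rw [h]; simp⟩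

theorem sum_neighborMatrix_mul {n : ℕ} (D : Finset (Fin n → ℤ)) {v : (Fin n → ℤ) → ℝ}
    (hv : ∀ x ∉ D, v x = 0) (x : D) :
    ∑ y : D, neighborMatrix D x y * v y = neighborSum v x := by
  have h : ∀ z : Fin n → ℤ, ∑ y : D, (if (y : Fin n → ℤ) = z then (1 : ℝ) else 0) * v y = v z := by
    intro z
    rw [Finset.sum_coe_sort D fun y => (if y = z then (1 : ℝ) else 0) * v y]
    simp only [ite_mul, one_mul, zero_mul, Finset.sum_ite_eq']
    split_ifs with hz
    · rfl
    · exact (hv z hz).symm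
  simp only [neighborMatrix, Finset.sum_mul, add_mul]
  rw [Finset.sum_comm]
  refine Finset.sum_congr rfl fun j _ => ?_
  rw [Finset.sum_add_distrib, h, h]

/-- The variational characterization of the first Dirichlet eigenvalue. -/
theorem exists_rayleigh {n : ℕ} {δ : ℝ} (hδ : 0 < δ) {D : Finset (Fin n → ℤ)}
    (hD : D.Nonempty) :
    ∃ κ : ℝ, δ ^ 2 * firstDirichletEigenvalue δ (D : Set (Fin n → ℤ)) = κ ∧ 0 ≤ κ ∧
      ∀ v : (Fin n → ℤ) → ℝ, (∀ x ∉ D, v x = 0) →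
        κ * ∑ x ∈ D, v x ^ 2 ≤ ∑ x ∈ D, v x * (2 * n * v x - neighborSum v x) := by
  classical
  set A : Matrix D D ℝ := (2 * n : ℝ) • 1 - neighborMatrix D with hA
  have hherm : A.IsHermitian := by
    refine Matrix.IsHermitian.ext fun x y => ?_
    simp only [hA, Matrix.sub_apply, Matrix.smul_apply, neighborMatrix_symm D x y,
      Matrix.one_apply, star_trivial, eq_comm]
  have hAv : ∀ (v : (Fin n → ℤ) → ℝ), (∀ x ∉ D, v x = 0) → ∀ x : D,
      (A.mulVec fun y : D => v y) x = 2 * n * v x - neighborSum v x := by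
    intro v hv x
    rw [hA, Matrix.sub_mulVec, Matrix.smul_mulVec, Matrix.one_mulVec, Pi.sub_apply, Pi.smul_apply,
      smul_eq_mul, ← sum_neighborMatrix_mul D hv x]
    rfl
  set T := Matrix.toEuclideanLin A with hT
  have hsymm : T.IsSymmetric := Matrix.isSymmetric_toEuclideanLin_iff.2 hherm
  have : Nonempty D := hD.to_subtype
  have hev := hsymm.hasEigenvalue_iInf_of_finiteDimensional
  set κ : ℝ := ⨅ w : { w : EuclideanSpace ℝ D // w ≠ 0 },
    RCLike.re (inner ℝ (T w) (w : EuclideanSpace ℝ D)) / ‖(w : EuclideanSpace ℝ D)‖ ^ 2 with hκ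
  have hbdd : BddBelow (Set.range fun w : { w : EuclideanSpace ℝ D // w ≠ 0 } =>
      RCLike.re (inner ℝ (T w) (w : EuclideanSpace ℝ D)) / ‖(w : EuclideanSpace ℝ D)‖ ^ 2) := by
    refine ⟨-‖LinearMap.toContinuousLinearMap T‖, ?_⟩
    rintro _ ⟨⟨w, hw⟩, rfl⟩
    have hw' : 0 < ‖w‖ ^ 2 := by positivity
    simp only [RCLike.re_to_real]
    rw [le_div_iff₀ hw']
    have h1 := abs_real_inner_le_norm (T w) w
    have h2 : ‖T w‖ ≤ ‖LinearMap.toContinuousLinearMap T‖ * ‖w‖ :=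
      (LinearMap.toContinuousLinearMap T).le_opNorm w
    have h3 := neg_abs_le (inner ℝ (T w) w)
    nlinarith [norm_nonneg w]
  have hray : ∀ w : EuclideanSpace ℝ D, κ * ‖w‖ ^ 2 ≤ inner ℝ (T w) w := by
    intro w
    by_cases hw : w = 0
    · simp [hw]
    · have hw' : 0 < ‖w‖ ^ 2 := by positivity
      rw [← le_div_iff₀ hw']
      exact ciInf_le hbdd ⟨w, hw⟩
  have hvar : ∀ v : (Fin n → ℤ) → ℝ, (∀ x ∉ D, v x = 0) →
      κ * ∑ x ∈ D, v x ^ 2 ≤ ∑ x ∈ D, v x * (2 * n * v x - neighborSum v x) := by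
    intro v hv
    have h1 := hray (WithLp.toLp 2 fun x : D => v x)
    have h2 : ‖(WithLp.toLp 2 fun x : D => v x : EuclideanSpace ℝ D)‖ ^ 2 = ∑ x ∈ D, v x ^ 2 := by
      rw [EuclideanSpace.real_norm_sq_eq]
      exact Finset.sum_coe_sort D fun x => v x ^ 2
    have h3 : inner ℝ (T (WithLp.toLp 2 fun x : D => v x)) (WithLp.toLp 2 fun x : D => v x) =
        ∑ x ∈ D, v x * (2 * n * v x - neighborSum v x) := by
      rw [PiLp.inner_apply, ← Finset.sum_coe_sort D]
      refine Finset.sum_congr rfl fun x _ => ?_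
      rw [← hAv v hv x]
      rfl
    rwa [h2, h3] at h1
  obtain ⟨w, hw⟩ := hev.exists_hasEigenvector
  set f : (Fin n → ℤ) → ℝ := fun x => if hx : x ∈ D then w ⟨x, hx⟩ else 0 with hf
  have hfD : ∀ x : D, f x = w x := fun x => by simp [hf]
  have hf0 : ∀ x ∉ D, f x = 0 := fun x hx => by simp [hf, hx]
  have hfe : ∀ x ∈ D, 2 * n * f x - neighborSum f x = κ * f x := by
    intro x hx
    rw [← hAv f hf0 ⟨x, hx⟩]
    have h1 := congrArg (fun u : EuclideanSpace ℝ D => u ⟨x, hx⟩) hw.apply_eq_smul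
    simp only [PiLp.smul_apply, smul_eq_mul] at h1
    rw [hfD ⟨x, hx⟩]
    refine Eq.trans ?_ h1
    have : (fun y : D => f y) = w.ofLp := funext hfD
    rw [this]
    rfl
  obtain ⟨x₀, hx₀, hne⟩ : ∃ x ∈ D, f x ≠ 0 := by
    by_contra! h
    refine hw.2 ?_
    ext x
    rw [← hfD x]
    exact h x x.2
  -- Evaluate the eigenvalue equation where `|f|` is largest: the neighbour sum is at most `2 n |f
  -- x|` in absolute value, so `2 n - κ ≤ 2 n`.
  have hκ0 : 0 ≤ κ := by
    obtain ⟨x, hx, hmax⟩ := D.exists_max_image (fun x => |f x|) hD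
    have hpos : 0 < |f x| := (abs_pos.2 hne).trans_le (hmax x₀ hx₀)
    have hle : ∀ y, |f y| ≤ |f x| := by
      intro y
      by_cases hy : y ∈ D
      · exact hmax y hy
      · rw [hf0 y hy, abs_zero]; exact hpos.le
    have h1 : |neighborSum f x| ≤ 2 * n * |f x| := by
      refine le_trans ?_ (neighborSum_le hle x)
      refine (Finset.abs_sum_le_sum_abs _ _).trans (Finset.sum_le_sum fun j _ => abs_add_le _ _)
    have h2 : neighborSum f x = (2 * n - κ) * f x := by linarith [hfe x hx]
    rw [h2, abs_mul] at h1
    have h3 := le_of_mul_le_mul_right h1 hpos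
    linarith [le_abs_self (2 * (n : ℝ) - κ)]
  have hleast : IsLeast {μ | IsDirichletEigenvalue δ (D : Set (Fin n → ℤ)) μ} (κ / δ ^ 2) := by
    constructor
    · refine ⟨f, ⟨x₀, hx₀, hne⟩, fun x hx => hf0 x hx.1, fun x hx => ?_⟩
      rw [discreteLaplacian_eq, div_mul_eq_mul_div, ← hfe x hx]
      ring
    · rintro μ ⟨g, ⟨y₀, hy₀, hgne⟩, hgb, hge⟩
      -- Cutting `g` off outside `D` does not change its neighbour sums at points of `D`, because
      -- `g` vanishes on the discrete boundary.
      set v : (Fin n → ℤ) → ℝ := fun x => if x ∈ D then g x else 0 with hv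
      have hv0 : ∀ x ∉ D, v x = 0 := fun x hx => by simp [hv, hx]
      have hvg : ∀ x ∈ D, v x = g x := fun x hx => by simp [hv, hx]
      have hve : ∀ x ∈ D, 2 * n * v x - neighborSum v x = δ ^ 2 * μ * v x := by
        intro x hx
        have h1 : neighborSum v x = neighborSum g x := by
          refine neighborSum_congr fun y hy => ?_
          by_cases hyD : y ∈ D
          · exact hvg y hyD
          · rw [hv0 y hyD, hgb y ⟨hyD, x, hx, latticeNeighbor_comm.1 hy⟩]
        have h2 := hge x hx
        rw [discreteLaplacian_eq] at h2
        rw [h1, hvg x hx, mul_assoc (δ ^ 2), ← h2]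
        field_simp
        ring
      have h1 := hvar v hv0
      have h2 : ∑ x ∈ D, v x * (2 * n * v x - neighborSum v x) =
          δ ^ 2 * μ * ∑ x ∈ D, v x ^ 2 := by
        rw [Finset.mul_sum]
        exact Finset.sum_congr rfl fun x hx => by rw [hve x hx]; ring
      have h3 : 0 < ∑ x ∈ D, v x ^ 2 :=
        Finset.sum_pos' (fun _ _ => sq_nonneg _)
          ⟨y₀, hy₀, by rw [hvg y₀ hy₀]; positivity⟩
      rw [h2] at h1
      rw [div_le_iff₀ (by positivity)]
      linarith [le_of_mul_le_mul_right h1 h3]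
  refine ⟨κ, ?_, hκ0, hvar⟩
  rw [firstDirichletEigenvalue, hleast.csInf_eq]
  field_simp

/-- The growth exponent in units of the mesh, and the Rayleigh inequality it enters. -/
theorem exists_growthExponent_eq {n : ℕ} {δ : ℝ} (hδ : 0 < δ) {D : Finset (Fin n → ℤ)}
    (hD : D.Nonempty) :
    ∃ α : ℝ, 0 ≤ α ∧ δ * growthExponent δ (D : Set (Fin n → ℤ)) = α ∧
      ∀ v : (Fin n → ℤ) → ℝ, (∀ x ∉ D, v x = 0) →
        (2 * Real.cosh α - 2) * ∑ x ∈ D, v x ^ 2 ≤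
          ∑ x ∈ D, v x * (2 * n * v x - neighborSum v x) := by
  obtain ⟨κ, hκ, hκ0, hvar⟩ := exists_rayleigh hδ hD
  refine ⟨Real.arcosh (1 + κ / 2), Real.arcosh_nonneg (by linarith), ?_, ?_⟩
  · rw [growthExponent, hκ, ← mul_assoc, mul_inv_cancel₀ hδ.ne', one_mul]
  · rw [Real.cosh_arcosh (by linarith)]
    convert hvar using 5
    ring

/-- From `cosh a - 1 = 2 sinh² (a / 2)` and `sinh t ≥ t` for `t ≥ 0`. It turns upper bounds on the
eigenvalue into bounds on the growth rate. -/
theorem sq_le_two_mul_cosh_sub_two (a : ℝ) : a ^ 2 ≤ 2 * Real.cosh a - 2 := by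
  have h1 : Real.cosh a = 1 + 2 * Real.sinh (|a| / 2) ^ 2 := by
    rw [← Real.cosh_abs, show |a| = 2 * (|a| / 2) by ring, Real.cosh_two_mul, Real.cosh_sq]
    ring_nf
  have h2 : |a| / 2 ≤ Real.sinh (|a| / 2) := Real.self_le_sinh_iff.2 (by positivity)
  have h3 : (|a| / 2) ^ 2 ≤ Real.sinh (|a| / 2) ^ 2 := by gcongr
  rw [div_pow, sq_abs] at h3
  linarith

/-- Test the Rayleigh inequality with `v`; points where `v` vanishes contribute nothing, so the
differential inequality is needed only where `v` is positive. -/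
theorem rayleigh_le_of_subsolution {n : ℕ} {D : Finset (Fin n → ℤ)} {κ lam : ℝ}
    {v : (Fin n → ℤ) → ℝ}
    (hvar : κ * ∑ x ∈ D, v x ^ 2 ≤ ∑ x ∈ D, v x * (2 * n * v x - neighborSum v x))
    (hv : ∀ x, 0 ≤ v x) (hle : ∀ x, 0 < v x → 2 * n * v x - neighborSum v x ≤ lam * v x)
    {x₀ : Fin n → ℤ} (hx₀ : x₀ ∈ D) (hpos : 0 < v x₀) : κ ≤ lam := by
  have h1 : ∑ x ∈ D, v x * (2 * n * v x - neighborSum v x) ≤ lam * ∑ x ∈ D, v x ^ 2 := by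
    rw [Finset.mul_sum]
    refine Finset.sum_le_sum fun x _ => ?_
    rcases (hv x).eq_or_lt with h | h
    · rw [← h]; simp
    · have := mul_le_mul_of_nonneg_left (hle x h) h.le
      linarith
  have h2 : 0 < ∑ x ∈ D, v x ^ 2 :=
    Finset.sum_pos' (fun _ _ => sq_nonneg _) ⟨x₀, hx₀, by positivity⟩
  exact le_of_mul_le_mul_right (hvar.trans h1) h2

/-- The test function is a point mass. This crude bound serves coarse meshes. -/
theorem rayleigh_le_two_mul {n : ℕ} {D : Finset (Fin n → ℤ)} {κ : ℝ} (hD : D.Nonempty)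
    (hvar : ∀ v : (Fin n → ℤ) → ℝ, (∀ x ∉ D, v x = 0) →
      κ * ∑ x ∈ D, v x ^ 2 ≤ ∑ x ∈ D, v x * (2 * n * v x - neighborSum v x)) :
    κ ≤ 2 * n := by
  obtain ⟨x₀, hx₀⟩ := hD
  have hv : ∀ x, 0 ≤ (Pi.single x₀ (1 : ℝ) : (Fin n → ℤ) → ℝ) x := fun x =>
    (Pi.single_nonneg.2 zero_le_one : (0 : (Fin n → ℤ) → ℝ) ≤ Pi.single x₀ 1) x
  refine rayleigh_le_of_subsolution (hvar (Pi.single x₀ 1) fun x hx => ?_) hv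
    (fun x _ => ?_) hx₀ (by simp)
  · exact Pi.single_eq_of_ne (fun h : x = x₀ => hx (h ▸ hx₀)) _
  · linarith [neighborSum_nonneg hv x]

/-- The test function is the product of cosines that vanishes on the faces of the box, truncated
outside it; its eigenvalue is `n (2 - 2 cos θ) ≤ n θ²`. -/
theorem rayleigh_le_of_box_subset {n : ℕ} {D : Finset (Fin n → ℤ)} {κ : ℝ}
    (hvar : ∀ v : (Fin n → ℤ) → ℝ, (∀ x ∉ D, v x = 0) →
      κ * ∑ x ∈ D, v x ^ 2 ≤ ∑ x ∈ D, v x * (2 * n * v x - neighborSum v x))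
    (c : Fin n → ℤ) {m : ℕ} (hm : 0 < m)
    (hbox : ∀ x : Fin n → ℤ, (∀ j, |x j - c j| ≤ (m : ℤ)) → x ∈ D) :
    κ ≤ n * (Real.pi / (2 * m)) ^ 2 := by
  classical
  have hm' : (0 : ℝ) < m := by positivity
  set θ : ℝ := Real.pi / (2 * m) with hθ
  have hθm : θ * m = Real.pi / 2 := by rw [hθ]; field_simp
  have hθ0 : 0 < θ := by positivity
  set g : (Fin n → ℤ) → ℝ := fun x => ∏ j, Real.cos (θ * (x j - c j)) with hg
  set v : (Fin n → ℤ) → ℝ := fun x => if ∀ j, |x j - c j| ≤ (m : ℤ) then g x else 0 with hv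
  have hang : ∀ (x : Fin n → ℤ) j, |θ * ((x j : ℝ) - c j)| = θ * ((|x j - c j| : ℤ) : ℝ) := by
    intro x j
    rw [abs_mul, abs_of_pos hθ0]
    push_cast
    rfl
  have hv0 : ∀ x, 0 ≤ v x := by
    intro x
    simp only [hv]
    split_ifs with h
    · refine Finset.prod_nonneg fun j _ => Real.cos_nonneg_of_mem_Icc ?_
      have h1 : |θ * ((x j : ℝ) - c j)| ≤ Real.pi / 2 := by
        rw [hang, ← hθm]
        exact mul_le_mul_of_nonneg_left (by exact_mod_cast h j) hθ0.le
      exact ⟨by linarith [(abs_le.1 h1).1], (abs_le.1 h1).2⟩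
    · exact le_rfl
  have hc : v c = 1 := by simp [hv, hg]
  have hcD : c ∈ D := hbox c (by simp)
  refine rayleigh_le_of_subsolution (hvar v fun x hx => ?_) hv0 (fun x hx => ?_) hcD
    (by rw [hc]; exact one_pos)
  · simp only [hv]
    rw [if_neg fun h => hx (hbox x h)]
  · have hin : ∀ j, |x j - c j| ≤ (m : ℤ) := by
      by_contra h
      simp only [hv] at hx
      rw [if_neg h] at hx
      exact lt_irrefl _ hx
    have hvx : v x = g x := by simp only [hv]; rw [if_pos hin]
    -- A point where `v` is positive is off the faces, so its neighbours stay in the box and the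
    -- truncation is not seen there.
    have hlt : ∀ j, |x j - c j| < (m : ℤ) := by
      intro j
      refine lt_of_le_of_ne (hin j) fun h => ?_
      have h1 : Real.cos (θ * ((x j : ℝ) - c j)) = 0 := by
        rw [← Real.cos_abs, hang, h]
        push_cast
        rw [hθm, Real.cos_pi_div_two]
      have h2 : g x = 0 := Finset.prod_eq_zero (Finset.mem_univ j) h1
      rw [hvx, h2] at hx
      exact lt_irrefl _ hx
    have hnb : neighborSum v x = neighborSum g x := by
      refine neighborSum_congr fun y hy => ?_
      simp only [hv]
      rw [if_pos]
      intro j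
      obtain ⟨i, rfl | rfl⟩ := hy
      · have h3 := hlt j
        by_cases hij : j = i
        · subst hij
          simp only [Pi.add_apply, Pi.single_eq_same]
          rw [abs_lt] at h3
          exact abs_le.2 ⟨by omega, by omega⟩
        · simpa [Pi.single_eq_of_ne hij] using h3.le
      · have h3 := hlt j
        by_cases hij : j = i
        · subst hij
          simp only [Pi.sub_apply, Pi.single_eq_same]
          rw [abs_lt] at h3
          exact abs_le.2 ⟨by omega, by omega⟩
        · simpa [Pi.single_eq_of_ne hij] using h3.le
    have hge : neighborSum g x = 2 * (n * Real.cos θ) * g x := by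
      have := neighborSum_prod_cos (fun _ => θ) (fun j => (c j : ℝ)) x
      simpa using this
    have hcos := Real.one_sub_sq_div_two_le_cos (x := θ)
    rw [hnb, hge, hvx]
    rw [hvx] at hx
    have hn : (0 : ℝ) ≤ n := by positivity
    have h5 : (n : ℝ) * (2 - 2 * Real.cos θ) ≤ n * θ ^ 2 :=
      mul_le_mul_of_nonneg_left (by linarith) hn
    have h6 := mul_le_mul_of_nonneg_right h5 hx.le
    linarith

/-! ### Decay of horizontal ℓ² norms. -/

/-- Exponential decay of the norms of the horizontal sections of a subharmonic function. -/
theorem sqrt_sum_sq_le_of_subharmonic {n L : ℕ} {D : Finset (Fin n → ℤ)} {α S : ℝ}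
    {U : (Fin n → ℤ) → ℤ → ℝ}
    (hvar : ∀ v : (Fin n → ℤ) → ℝ, (∀ x ∉ D, v x = 0) →
      (2 * Real.cosh α - 2) * ∑ x ∈ D, v x ^ 2 ≤
        ∑ x ∈ D, v x * (2 * n * v x - neighborSum v x))
    (hU0 : ∀ x k, 0 ≤ U x k) (hUD : ∀ x ∉ D, ∀ k, U x k = 0)
    (hsub : ∀ x ∈ D, ∀ k : ℤ, |k| < (L : ℤ) →
      2 * (n + 1) * U x k ≤ neighborSum (fun y => U y k) x + (U x (k + 1) + U x (k - 1)))
    (hcap : ∀ k : ℤ, |k| = (L : ℤ) → √(∑ x ∈ D, U x k ^ 2) ≤ S)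
    (k : ℤ) (hk : |k| ≤ (L : ℤ)) :
    √(∑ x ∈ D, U x k ^ 2) ≤ S * (Real.cosh (α * k) / Real.cosh (α * L)) := by
  set e : ℤ → ℝ := fun k => √(∑ x ∈ D, U x k ^ 2) with he
  have hsq : ∀ k, ∑ x ∈ D, U x k ^ 2 = e k ^ 2 := fun k =>
    (Real.sq_sqrt (Finset.sum_nonneg fun _ _ => sq_nonneg _)).symm
  have he0 : ∀ k, 0 ≤ e k := fun k => Real.sqrt_nonneg _
  have hstep : ∀ k : ℤ, |k| < (L : ℤ) → 2 * Real.cosh α * e k ≤ e (k + 1) + e (k - 1) := by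
    intro k hk
    rcases (he0 k).eq_or_lt with h | h
    · rw [← h]; simpa using add_nonneg (he0 (k + 1)) (he0 (k - 1))
    have h1 := hvar (fun x => U x k) fun x hx => hUD x hx k
    rw [hsq] at h1
    have h2 : ∑ x ∈ D, U x k * (2 * n * U x k - neighborSum (fun y => U y k) x) ≤
        ∑ x ∈ D, (U x k * U x (k + 1) + U x k * U x (k - 1) - 2 * U x k ^ 2) :=
      Finset.sum_le_sum fun x hx => by
        have := mul_le_mul_of_nonneg_left (hsub x hx k hk) (hU0 x k)
        linarith
    rw [Finset.sum_sub_distrib, Finset.sum_add_distrib, ← Finset.mul_sum, hsq] at h2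
    have h3 := Real.sum_mul_le_sqrt_mul_sqrt D (fun x => U x k) fun x => U x (k + 1)
    have h4 := Real.sum_mul_le_sqrt_mul_sqrt D (fun x => U x k) fun x => U x (k - 1)
    change _ ≤ e k * e (k + 1) at h3
    change _ ≤ e k * e (k - 1) at h4
    refine le_of_mul_le_mul_left ?_ h
    linarith
  -- The comparison of sequences is the maximum principle in horizontal dimension zero; `1 ≤ cosh α`
  -- makes the difference subharmonic where it is positive.
  set w : (Fin 0 → ℤ) → ℤ → ℝ :=
    fun _ k => e k - S * (Real.cosh (α * k) / Real.cosh (α * L)) with hw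
  have := slab_nonpos_of_subharmonic (W := w) (r := L) {0}
    (fun x l _ _ => ⟨0, by simp, le_rfl⟩) ?_ ?_ 0 k hk
  · simpa [hw] using this
  · intro _ l hl
    have h1 : Real.cosh (α * l) = Real.cosh (α * L) := by
      rw [← Real.cosh_abs, abs_mul, ← Int.cast_abs, hl, ← Real.cosh_abs (α * L), abs_mul]
      simp
    simp only [hw]
    rw [h1, div_self (Real.cosh_pos _).ne', mul_one]
    linarith [hcap l hl]
  · intro _ l hl hpos
    simp only [hw, neighborSum, Finset.univ_eq_empty, Finset.sum_empty] at hpos ⊢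
    have h1 := hstep l hl
    have h2 := cosh_add_one_add_cosh_sub_one α l
    have h3 : S * (Real.cosh (α * ((l + 1 : ℤ) : ℝ)) / Real.cosh (α * L)) +
        S * (Real.cosh (α * ((l - 1 : ℤ) : ℝ)) / Real.cosh (α * L)) =
        2 * Real.cosh α * (S * (Real.cosh (α * l) / Real.cosh (α * L))) := by
      rw [← mul_add, ← add_div, h2]
      ring
    have h4 := mul_le_mul_of_nonneg_right (Real.one_le_cosh α) hpos.le
    push_cast at h3 ⊢
    linarith

/-! ### Coordinates on the cylinder. -/

/-- The lattice point over `x` with integer height coordinate `k`. -/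
abbrev latticeLift {n : ℕ} (x : Fin n → ℤ) (k : ℤ) : Fin (n + 1) → ℤ :=
  Fin.snoc (α := fun _ => ℤ) x k

theorem latticeLift_init {n : ℕ} (x : Fin (n + 1) → ℤ) :
    latticeLift (Fin.init x) (x (Fin.last n)) = x :=
  Fin.snoc_init_self x

theorem latticeHeight_latticeLift {n : ℕ} (δ : ℝ) (x : Fin n → ℤ) (k : ℤ) :
    latticeHeight δ (latticeLift x k) = δ * k := by
  simp [latticeHeight, latticeLift]

theorem latticeLift_add_single_castSucc {n : ℕ} (x : Fin n → ℤ) (k : ℤ) (j : Fin n) (a : ℤ) :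
    latticeLift x k + Pi.single j.castSucc a = latticeLift (x + Pi.single j a) k := by
  ext i
  refine Fin.lastCases ?_ (fun i => ?_) i
  · simp
  · simp [Pi.single_apply]

theorem latticeLift_add_single_last {n : ℕ} (x : Fin n → ℤ) (k a : ℤ) :
    latticeLift x k + Pi.single (Fin.last n) a = latticeLift x (k + a) := by
  ext i
  refine Fin.lastCases ?_ (fun i => ?_) i
  · simp
  · simp

theorem latticeLift_sub_single_castSucc {n : ℕ} (x : Fin n → ℤ) (k : ℤ) (j : Fin n) (a : ℤ) :
    latticeLift x k - Pi.single j.castSucc a = latticeLift (x - Pi.single j a) k := by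
  rw [sub_eq_add_neg, ← Pi.single_neg, latticeLift_add_single_castSucc, Pi.single_neg,
    ← sub_eq_add_neg]

theorem latticeLift_sub_single_last {n : ℕ} (x : Fin n → ℤ) (k a : ℤ) :
    latticeLift x k - Pi.single (Fin.last n) a = latticeLift x (k - a) := by
  rw [sub_eq_add_neg, ← Pi.single_neg, latticeLift_add_single_last, ← sub_eq_add_neg]

theorem discreteLaplacian_latticeLift {n : ℕ} (δ : ℝ) (h : (Fin (n + 1) → ℤ) → ℝ)
    (x : Fin n → ℤ) (k : ℤ) :
    discreteLaplacian δ h (latticeLift x k) = (δ ^ 2)⁻¹ *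
      (neighborSum (fun y => h (latticeLift y k)) x +
        (h (latticeLift x (k + 1)) + h (latticeLift x (k - 1))) -
        2 * (n + 1) * h (latticeLift x k)) := by
  rw [discreteLaplacian, Fin.sum_univ_castSucc]
  simp only [latticeLift_add_single_castSucc, latticeLift_sub_single_castSucc,
    latticeLift_add_single_last, latticeLift_sub_single_last, neighborSum]
  push_cast
  rfl

/-! ### The excess of `|h|` over a boundary bound. -/

open Classical in
/-- The part of `|h|` above the level `B` over `D`, extended by zero. -/
noncomputable def excess {n : ℕ} (D : Finset (Fin n → ℤ)) (h : (Fin (n + 1) → ℤ) → ℝ) (B : ℝ)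
    (x : Fin n → ℤ) (k : ℤ) : ℝ :=
  if x ∈ D then max (|h (latticeLift x k)| - B) 0 else 0

section excess

variable {n : ℕ} {D : Finset (Fin n → ℤ)} {h : (Fin (n + 1) → ℤ) → ℝ} {B : ℝ}

theorem excess_nonneg (x : Fin n → ℤ) (k : ℤ) : 0 ≤ excess D h B x k := by
  unfold excess
  split_ifs
  · exact le_max_right _ _
  · exact le_rfl

theorem excess_of_notMem {x : Fin n → ℤ} (hx : x ∉ D) (k : ℤ) : excess D h B x k = 0 :=
  if_neg hx

theorem excess_of_mem {x : Fin n → ℤ} (hx : x ∈ D) (k : ℤ) :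
    excess D h B x k = max (|h (latticeLift x k)| - B) 0 :=
  if_pos hx

theorem le_excess {x : Fin n → ℤ} (hx : x ∈ D) (k : ℤ) :
    |h (latticeLift x k)| ≤ excess D h B x k + B := by
  rw [excess_of_mem hx]
  linarith [le_max_left (|h (latticeLift x k)| - B) 0]

theorem excess_le {M : ℝ} (hB : 0 ≤ B) {x : Fin n → ℤ} {k : ℤ}
    (hx : x ∈ D) (hM : |h (latticeLift x k)| ≤ M) : excess D h B x k ≤ M := by
  rw [excess_of_mem hx]
  exact max_le (by linarith) ((abs_nonneg _).trans hM)

/-- Where the excess is positive it equals `|h| - B`. At every neighbour `|h|` is at most the excess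
plus `B`, also across the lateral boundary, so the triangle inequality in the mean value property
suffices. -/
theorem excess_subharmonic {δ : ℝ} (hδ : 0 < δ) {x : Fin n → ℤ} (hx : x ∈ D) {k : ℤ}
    (hh : discreteLaplacian δ h (latticeLift x k) = 0)
    (hB : ∀ y ∈ discreteBoundary (D : Set (Fin n → ℤ)), |h (latticeLift y k)| ≤ B) :
    2 * (n + 1) * excess D h B x k ≤ neighborSum (fun y => excess D h B y k) x +
      (excess D h B x (k + 1) + excess D h B x (k - 1)) := by
  have hnn : 0 ≤ neighborSum (fun y => excess D h B y k) x :=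
    neighborSum_nonneg (fun y => excess_nonneg y k) x
  rcases (excess_nonneg (D := D) (h := h) (B := B) x k).eq_or_lt with h0 | h0
  · rw [← h0, mul_zero]
    exact add_nonneg hnn (add_nonneg (excess_nonneg _ _) (excess_nonneg _ _))
  have hval : excess D h B x k = |h (latticeLift x k)| - B := by
    rw [excess_of_mem hx] at h0 ⊢
    exact max_eq_left ((lt_max_iff.1 h0).resolve_right (lt_irrefl _)).le
  have hnb : ∀ y, LatticeNeighbor x y → |h (latticeLift y k)| ≤ excess D h B y k + B := by
    intro y hy
    by_cases hyD : y ∈ D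
    · exact le_excess hyD k
    · rw [excess_of_notMem hyD, zero_add]
      exact hB y ⟨hyD, x, hx, latticeNeighbor_comm.1 hy⟩
  rw [discreteLaplacian_latticeLift] at hh
  have hh' := (mul_eq_zero.1 hh).resolve_left (by positivity)
  have h1 : |neighborSum (fun y => h (latticeLift y k)) x| ≤
      neighborSum (fun y => excess D h B y k) x + 2 * n * B := by
    calc |neighborSum (fun y => h (latticeLift y k)) x|
        ≤ ∑ j : Fin n, ((excess D h B (x + Pi.single j 1) k + excess D h B (x - Pi.single j 1) k) +
            2 * B) := by
          refine (Finset.abs_sum_le_sum_abs _ _).trans (Finset.sum_le_sum fun j _ => ?_)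
          refine (abs_add_le _ _).trans ?_
          linarith [hnb _ ⟨j, Or.inl rfl⟩, hnb _ ⟨j, Or.inr rfl⟩]
      _ = _ := by
          rw [Finset.sum_add_distrib]
          simp only [neighborSum, Finset.sum_const, Finset.card_univ, Fintype.card_fin,
            nsmul_eq_mul]
          ring
  have h2 : 2 * (n + 1) * |h (latticeLift x k)| =
      |neighborSum (fun y => h (latticeLift y k)) x +
        (h (latticeLift x (k + 1)) + h (latticeLift x (k - 1)))| := by
    rw [sub_eq_zero.1 hh', abs_mul, abs_of_nonneg (by positivity : (0 : ℝ) ≤ 2 * (n + 1))]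
  have h3 := abs_add_le (neighborSum (fun y => h (latticeLift y k)) x)
    (h (latticeLift x (k + 1)) + h (latticeLift x (k - 1)))
  have h4 := abs_add_le (h (latticeLift x (k + 1))) (h (latticeLift x (k - 1)))
  have h5 := le_excess (h := h) (B := B) hx (k + 1)
  have h6 := le_excess (h := h) (B := B) hx (k - 1)
  rw [hval]
  linarith

end excess

/-! ### Norm comparison and the geometry of the mesh. -/

theorem sqrt_sum_sq_le {ι : Type*} (D : Finset ι) {u : ι → ℝ} {M : ℝ} (hM : 0 ≤ M)
    (hu0 : ∀ x ∈ D, 0 ≤ u x) (hu : ∀ x ∈ D, u x ≤ M) : √(∑ x ∈ D, u x ^ 2) ≤ √D.card * M := by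
  rw [← Real.sqrt_sq hM, ← Real.sqrt_mul (by positivity)]
  refine Real.sqrt_le_sqrt ?_
  rw [← nsmul_eq_mul]
  exact Finset.sum_le_card_nsmul _ _ _ fun x hx => pow_le_pow_left₀ (hu0 x hx) (hu x hx) 2

theorem sum_le_sqrt_card_mul {ι : Type*} (D : Finset ι) (u : ι → ℝ) :
    ∑ x ∈ D, u x ≤ √D.card * √(∑ x ∈ D, u x ^ 2) := by
  simpa using Real.sum_mul_le_sqrt_mul_sqrt D (fun _ => (1 : ℝ)) u

/-- Step outwards from a point of maximal first coordinate. In (ii) this forces `0 ≤ B`. -/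
theorem discreteBoundary_nonempty {n : ℕ} (hn : 1 ≤ n) {D : Finset (Fin n → ℤ)}
    (hD : D.Nonempty) : (discreteBoundary (D : Set (Fin n → ℤ))).Nonempty := by
  obtain ⟨x, hx, hmax⟩ := D.exists_max_image (fun x => x ⟨0, hn⟩) hD
  refine ⟨x + Pi.single ⟨0, hn⟩ 1, fun h => ?_, x, hx, ⟨0, hn⟩, Or.inr (by simp)⟩
  have := hmax _ h
  simp at this

theorem exists_meshPoints_finset {n : ℕ} {Ω : Set (EuclideanSpace ℝ (Fin n))}
    (hΩ : Bornology.IsBounded Ω) :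
    ∃ R : ℝ, 0 < R ∧ ∀ δ : ℝ, 0 < δ → ∃ D : Finset (Fin n → ℤ),
      (D : Set (Fin n → ℤ)) = meshPoints δ Ω ∧ (D.card : ℝ) ≤ (2 * (R / δ) + 1) ^ n := by
  classical
  obtain ⟨R, hR, hΩR⟩ := hΩ.exists_pos_norm_le
  refine ⟨R, hR, fun δ hδ => ?_⟩
  set m : ℤ := ⌊R / δ⌋ with hm
  have hm0 : 0 ≤ m := Int.floor_nonneg.2 (by positivity)
  have hsub : meshPoints δ Ω ⊆ (Fintype.piFinset fun _ : Fin n => Finset.Icc (-m) m :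
      Finset (Fin n → ℤ)) := by
    intro x hx
    simp only [Finset.mem_coe, Fintype.mem_piFinset, Finset.mem_Icc, ← abs_le]
    intro j
    rw [hm, Int.le_floor, le_div_iff₀ hδ]
    have h1 := (PiLp.norm_apply_le (WithLp.toLp 2 fun i => δ * (x i : ℝ) :
      EuclideanSpace ℝ (Fin n)) j).trans (hΩR _ hx)
    rw [Real.norm_eq_abs, abs_mul, abs_of_pos hδ] at h1
    push_cast
    linarith
  have hfin := (Finset.finite_toSet _).subset hsub
  refine ⟨hfin.toFinset, hfin.coe_toFinset, ?_⟩
  have hcard := Finset.card_le_card (hfin.toFinset_subset.2 hsub)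
  rw [Fintype.card_piFinset] at hcard
  simp only [Int.card_Icc, Finset.prod_const, Finset.card_univ, Fintype.card_fin] at hcard
  calc (hfin.toFinset.card : ℝ) ≤ (((m + 1 - -m).toNat : ℕ) : ℝ) ^ n := by exact_mod_cast hcard
    _ ≤ (2 * (R / δ) + 1) ^ n := by
      have h2 : (((m + 1 - -m).toNat : ℕ) : ℝ) = 2 * m + 1 := by
        have : (((m + 1 - -m).toNat : ℕ) : ℤ) = 2 * m + 1 := by omega
        exact_mod_cast this
      have h3 : (m : ℝ) ≤ R / δ := Int.floor_le _
      rw [h2]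
      have h4 : (0 : ℝ) ≤ m := by exact_mod_cast hm0
      gcongr

theorem exists_cube_subset {n : ℕ} {Ω : Set (EuclideanSpace ℝ (Fin n))} (hΩ : IsOpen Ω)
    (hne : Ω.Nonempty) :
    ∃ (p : Fin n → ℝ) (s : ℝ), 0 < s ∧
      ∀ y : Fin n → ℝ, (∀ j, |y j - p j| < s) → WithLp.toLp 2 y ∈ Ω := by
  obtain ⟨q, hq⟩ := hne
  have hopen : IsOpen ((fun y : Fin n → ℝ => (WithLp.toLp 2 y : EuclideanSpace ℝ (Fin n))) ⁻¹' Ω) :=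
    hΩ.preimage (PiLp.continuous_toLp 2 _)
  obtain ⟨s, hs, hball⟩ := Metric.isOpen_iff.1 hopen q.ofLp hq
  refine ⟨q.ofLp, s, hs, fun y hy => hball ?_⟩
  rw [Metric.mem_ball, dist_pi_lt_iff hs]
  exact fun j => by rw [Real.dist_eq]; exact hy j

/-- For a fixed open set, the growth exponents of its discretizations are bounded in the units
given by one plus the mesh. -/
theorem exists_rate_mul_ceil_le {n : ℕ} {Ω : Set (EuclideanSpace ℝ (Fin n))} (hΩ : IsOpen Ω)
    (hne : Ω.Nonempty) :
    ∃ K : ℝ, ∀ δ : ℝ, 0 < δ → ∀ D : Finset (Fin n → ℤ), D.Nonempty →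
      (D : Set (Fin n → ℤ)) = meshPoints δ Ω → ∀ α : ℝ, 0 ≤ α →
      (∀ v : (Fin n → ℤ) → ℝ, (∀ x ∉ D, v x = 0) →
        (2 * Real.cosh α - 2) * ∑ x ∈ D, v x ^ 2 ≤
          ∑ x ∈ D, v x * (2 * n * v x - neighborSum v x)) →
      α * ⌈δ⁻¹⌉₊ ≤ K := by
  obtain ⟨p, s, hs, hcube⟩ := exists_cube_subset hΩ hne
  refine ⟨2 * n * Real.pi / s * (1 + s / 4) + 2 * n * (4 / s + 1),
    fun δ hδ D hD hDΩ α hα hvar => ?_⟩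
  have hceil : (⌈δ⁻¹⌉₊ : ℝ) ≤ δ⁻¹ + 1 := (Nat.ceil_lt_add_one (by positivity)).le
  -- Lets `α² ≤ n θ²` be relaxed to `α ≤ n θ` without a square root of `n`.
  have hnn : (n : ℝ) ≤ n ^ 2 := by
    exact_mod_cast Nat.le_self_pow two_ne_zero n
  have hpi := Real.pi_pos
  have hp1 : 0 ≤ 2 * n * Real.pi / s * (1 + s / 4) := by positivity
  have hp2 : 0 ≤ 2 * n * (4 / s + 1) := by positivity
  have hsq := sq_le_two_mul_cosh_sub_two α
  rcases le_or_gt δ (s / 4) with hδs | hδs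
  · have hq1 : 1 ≤ s / (4 * δ) := by rw [le_div_iff₀ (by positivity)]; linarith
    -- Half the cube is used: rounding its centre to the lattice costs at most `δ / 2 ≤ s / 8`, so
    -- the lattice box still fits.
    set m : ℕ := ⌊s / (2 * δ)⌋₊ with hm
    have hm1 : s / (4 * δ) ≤ m := by
      have h1 := (Nat.lt_floor_add_one (s / (2 * δ))).le
      have h2 : s / (2 * δ) = 2 * (s / (4 * δ)) := by field_simp; norm_num
      linarith
    have hm2 : (m : ℝ) * δ ≤ s / 2 := by
      have h1 : (m : ℝ) ≤ s / (2 * δ) := Nat.floor_le (by positivity)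
      rw [le_div_iff₀ (by positivity)] at h1
      linarith
    have hm0 : 0 < m := by
      have : (0 : ℝ) < m := by linarith
      exact_mod_cast this
    have hbox : ∀ x : Fin n → ℤ, (∀ j, |x j - round (p j / δ)| ≤ (m : ℤ)) → x ∈ D := by
      intro x hx
      rw [← Finset.mem_coe, hDΩ]
      refine hcube _ fun j => ?_
      have h1 : |((x j - round (p j / δ) : ℤ) : ℝ)| ≤ m := by exact_mod_cast hx j
      have h2 := abs_sub_round (p j / δ)
      have h3 : δ * (x j : ℝ) - p j =
          δ * (((x j - round (p j / δ) : ℤ) : ℝ) - (p j / δ - round (p j / δ))) := by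
        push_cast; field_simp; ring
      rw [h3, abs_mul, abs_of_pos hδ]
      have h4 := abs_sub ((x j - round (p j / δ) : ℤ) : ℝ) (p j / δ - round (p j / δ))
      have h5 := mul_le_mul_of_nonneg_left (h4.trans (add_le_add h1 h2)) hδ.le
      linarith
    have hκ := rayleigh_le_of_box_subset hvar (fun j => round (p j / δ)) hm0 hbox
    have hm0' : (0 : ℝ) < m := by exact_mod_cast hm0
    have h1 : α ≤ n * (Real.pi / (2 * m)) := by
      refine abs_le_of_sq_le_sq' ?_ (by positivity) |>.2
      rw [mul_pow]
      exact (hsq.trans hκ).trans (mul_le_mul_of_nonneg_right hnn (sq_nonneg _))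
    have h2 : Real.pi / (2 * m) ≤ 2 * Real.pi * δ / s := by
      calc Real.pi / (2 * m) ≤ Real.pi / (2 * (s / (4 * δ))) := by gcongr
        _ = 2 * Real.pi * δ / s := by field_simp; norm_num
    calc α * ⌈δ⁻¹⌉₊ ≤ (n * (2 * Real.pi * δ / s)) * (δ⁻¹ + 1) := by
          refine mul_le_mul (h1.trans ?_) hceil (by positivity) (by positivity)
          gcongr
      _ = 2 * n * Real.pi / s * (1 + δ) := by field_simp
      _ ≤ 2 * n * Real.pi / s * (1 + s / 4) := by gcongr
      _ ≤ _ := by linarith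
  · have hκ := rayleigh_le_two_mul hD hvar
    have h1 : α ≤ 2 * n := by
      refine abs_le_of_sq_le_sq' ?_ (by positivity) |>.2
      nlinarith
    have h2 : δ⁻¹ ≤ 4 / s := by
      rw [inv_le_comm₀ hδ (by positivity), inv_div]
      exact hδs.le
    calc α * ⌈δ⁻¹⌉₊ ≤ 2 * n * (4 / s + 1) := by
          refine mul_le_mul h1 (hceil.trans (by linarith)) (by positivity) (by positivity)
      _ ≤ _ := by linarith

/-! ### Decay uniform in the mesh. -/

/-- Exponential decay in the middle of a slab, with a constant independent of the mesh. -/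
theorem exists_exp_decay {n : ℕ} {Ω : Set (EuclideanSpace ℝ (Fin n))} (hΩ : IsOpen Ω)
    (hne : Ω.Nonempty) (hbdd : Bornology.IsBounded Ω) :
    ∃ C : ℝ, 0 < C ∧ ∀ δ : ℝ, 0 < δ → ∃ D : Finset (Fin n → ℤ),
      (D : Set (Fin n → ℤ)) = meshPoints δ Ω ∧
      (D.Nonempty → ∀ (L : ℕ) (U : (Fin n → ℤ) → ℤ → ℝ) (M : ℝ),
        (∀ x k, 0 ≤ U x k) → (∀ x ∉ D, ∀ k, U x k = 0) →
        (∀ x ∈ D, ∀ k : ℤ, |k| < (L : ℤ) →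
          2 * (n + 1) * U x k ≤ neighborSum (fun y => U y k) x + (U x (k + 1) + U x (k - 1))) →
        0 ≤ M → (∀ x ∈ D, ∀ k : ℤ, |k| = (L : ℤ) → U x k ≤ M) →
        ∀ x, U x 0 ≤ C * M * Real.exp (-(δ * growthExponent δ (meshPoints δ Ω) * L))) := by
  obtain ⟨R, hR, hmesh⟩ := exists_meshPoints_finset hbdd
  obtain ⟨K, hK⟩ := exists_rate_mul_ceil_le hΩ hne
  obtain ⟨C, hC, hmean⟩ := exists_slab_mean_value n
  refine ⟨Real.exp K * (1 + 4 * C * (2 * R + 1) ^ n), by positivity, fun δ hδ => ?_⟩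
  obtain ⟨D, hDΩ, hcard⟩ := hmesh δ hδ
  refine ⟨D, hDΩ, fun hD L U M hU0 hUD hsub hM hcap x => ?_⟩
  obtain ⟨α, hα, hαg, hvar⟩ := exists_growthExponent_eq hδ hD
  rw [hDΩ] at hαg
  rw [hαg]
  have hαr := hK δ hδ D hD hDΩ α hα hvar
  set r : ℕ := ⌈δ⁻¹⌉₊ with hr
  have hr0 : 0 < r := Nat.ceil_pos.2 (by positivity)
  have hr1 : (1 : ℝ) ≤ r := by exact_mod_cast hr0
  have hrδ : δ⁻¹ ≤ r := Nat.le_ceil _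
  have hcard' : (D.card : ℝ) ≤ (2 * R + 1) ^ n * (r : ℝ) ^ n := by
    rw [← mul_pow]
    refine hcard.trans ?_
    gcongr
    rw [div_eq_mul_inv]
    have := mul_le_mul_of_nonneg_left hrδ hR.le
    linarith
  have hexp : ∀ {t : ℝ}, t ≤ K → Real.exp t ≤ Real.exp K := Real.exp_le_exp.2
  have hq : 0 ≤ 4 * C * (2 * R + 1) ^ n := by positivity
  rcases le_or_gt r L with hrL | hrL
  -- Two factors `√D.card` appear, from bounding the end norms by `M` and from Cauchy–Schwarz at
  -- height `k`; their product is absorbed by `r ^ n` in the mean value inequality.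
  · have hrow : ∀ k : ℤ, |k| = (r : ℤ) →
        ∑ y ∈ D, U y k ≤ D.card * M * (Real.exp K * (2 * Real.exp (-(α * L)))) := by
      intro k hk
      have h1 := sqrt_sum_sq_le_of_subharmonic (S := √D.card * M) hvar hU0 hUD hsub
        (fun l hl => sqrt_sum_sq_le D hM (fun x _ => hU0 x l) fun x hx => hcap x hx l hl) k
        (by rw [hk]; exact_mod_cast hrL)
      have h2 : Real.cosh (α * k) ≤ Real.exp K := by
        rw [← Real.cosh_abs, abs_mul, abs_of_nonneg hα, ← Int.cast_abs, hk]
        exact (cosh_le_exp (by positivity)).trans (hexp (by exact_mod_cast hαr))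
      have h3 : Real.cosh (α * k) / Real.cosh (α * L) ≤
          Real.exp K * (2 * Real.exp (-(α * L))) := by
        rw [div_eq_mul_inv]
        exact mul_le_mul h2 (inv_cosh_le _) (inv_nonneg.2 (Real.cosh_pos _).le) (Real.exp_pos _).le
      calc ∑ y ∈ D, U y k ≤ √D.card * √(∑ y ∈ D, U y k ^ 2) := sum_le_sqrt_card_mul D _
        _ ≤ √D.card * (√D.card * M * (Real.exp K * (2 * Real.exp (-(α * L))))) := by
          gcongr
          exact h1.trans (mul_le_mul_of_nonneg_left h3 (by positivity))
        _ = √D.card * √D.card * M * (Real.exp K * (2 * Real.exp (-(α * L)))) := by ring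
        _ = _ := by rw [Real.mul_self_sqrt (by positivity)]
    have h4 := hmean r hr0 D U hU0 hUD
      (fun x hx k hk => hsub x hx k (hk.trans_le (by exact_mod_cast hrL))) x
    rw [Finset.sum_add_distrib] at h4
    have h5 := hrow r (by simp)
    have h6 := hrow (-r) (by simp)
    have hrn : (0 : ℝ) < (r : ℝ) ^ n := by positivity
    have hE := Real.exp_pos (-(α * L))
    have hEK := Real.exp_pos K
    calc U x 0 ≤ C / (r : ℝ) ^ n * (D.card * M * (Real.exp K * (2 * Real.exp (-(α * L)))) +
          D.card * M * (Real.exp K * (2 * Real.exp (-(α * L))))) :=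
          h4.trans (mul_le_mul_of_nonneg_left (add_le_add h5 h6) (by positivity))
      _ = 4 * C * Real.exp K * M * Real.exp (-(α * L)) * (D.card / (r : ℝ) ^ n) := by ring
      _ ≤ 4 * C * Real.exp K * M * Real.exp (-(α * L)) * (2 * R + 1) ^ n := by
        gcongr
        rwa [div_le_iff₀ hrn]
      _ = Real.exp K * (4 * C * (2 * R + 1) ^ n) * M * Real.exp (-(α * L)) := by ring
      _ ≤ _ := by gcongr; linarith
  -- For a short cylinder the maximum principle gives `U x 0 ≤ M`, and `α L ≤ α r ≤ K` keeps the
  -- exponential factor bounded below.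
  · have hUM : U x 0 - M ≤ 0 := by
      have hmem : ∀ z k, 0 < U z k - M → z ∈ D := by
        intro z k h
        by_contra hz
        rw [hUD z hz k] at h
        linarith
      refine slab_nonpos_of_subharmonic (W := fun z k => U z k - M) (r := L) D
        (fun z k _ h => ⟨z, hmem z k h, le_rfl⟩) (fun z k hk => ?_) (fun z k hk h => ?_) x 0
        (by simp)
      · by_contra! h
        linarith [hcap z (hmem z k h) k hk]
      · have h1 := hsub z (hmem z k h) k hk
        have h2 : neighborSum (fun _ => M) z = 2 * n * M := by
          simp [neighborSum]; ring
        rw [neighborSum_sub, h2]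
        linarith
    have h1 : α * L ≤ K := by
      refine le_trans ?_ hαr
      gcongr
    have h2 : 1 ≤ Real.exp K * Real.exp (-(α * L)) := by
      rw [← Real.exp_add]
      exact Real.one_le_exp (by linarith)
    calc U x 0 ≤ 1 * M := by linarith
      _ ≤ (Real.exp K * Real.exp (-(α * L)) * (1 + 4 * C * (2 * R + 1) ^ n)) * M := by
        gcongr
        exact h2.trans (le_mul_of_one_le_right (by positivity) (by linarith))
      _ = _ := by ring

/-! ### Phragmén–Lindelöf principle on the infinite cylinder. -/

/-- A Phragmén–Lindelöf principle for subharmonic functions on a cylinder. -/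
theorem eq_zero_of_subharmonic_of_growth {n : ℕ} {D : Finset (Fin n → ℤ)} {α : ℝ}
    {U : (Fin n → ℤ) → ℤ → ℝ}
    (hvar : ∀ v : (Fin n → ℤ) → ℝ, (∀ x ∉ D, v x = 0) →
      (2 * Real.cosh α - 2) * ∑ x ∈ D, v x ^ 2 ≤
        ∑ x ∈ D, v x * (2 * n * v x - neighborSum v x))
    (hU0 : ∀ x k, 0 ≤ U x k) (hUD : ∀ x ∉ D, ∀ k, U x k = 0)
    (hsub : ∀ x ∈ D, ∀ k : ℤ,
      2 * (n + 1) * U x k ≤ neighborSum (fun y => U y k) x + (U x (k + 1) + U x (k - 1)))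
    (hgrowth : ∀ ε : ℝ, 0 < ε → ∃ L₀ : ℕ, ∀ L : ℕ, L₀ ≤ L → ∀ x ∈ D, ∀ k : ℤ, |k| = (L : ℤ) →
      U x k ≤ ε * Real.exp (α * L)) (x : Fin n → ℤ) (k : ℤ) : U x k = 0 := by
  by_cases hx : x ∈ D
  swap
  · exact hUD x hx k
  set A : ℝ := √D.card * (2 * Real.cosh (α * k)) with hA
  have hA0 : 0 ≤ A := by have := Real.cosh_pos (α * k); positivity
  -- The growth `ε exp (α L)` at the ends is compensated by `1 / cosh (α L) ≤ 2 exp (-α L)`; the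
  -- resulting factor `A` depends on `k` but not on `L` or `ε`.
  have hbound : ∀ ε : ℝ, 0 < ε → U x k ≤ ε * A := by
    intro ε hε
    obtain ⟨L₀, hL₀⟩ := hgrowth ε hε
    set L : ℕ := max L₀ k.natAbs with hL
    have hM : 0 ≤ ε * Real.exp (α * L) := by positivity
    have h1 := sqrt_sum_sq_le_of_subharmonic (L := L) (S := √D.card * (ε * Real.exp (α * L))) hvar
      hU0 hUD (fun x hx k _ => hsub x hx k)
      (fun l hl => sqrt_sum_sq_le D hM (fun x _ => hU0 x l) fun x hx =>
        hL₀ L (le_max_left _ _) x hx l hl) k (by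
          rw [Int.abs_eq_natAbs]; exact_mod_cast le_max_right _ _)
    have h2 : U x k ≤ √(∑ y ∈ D, U y k ^ 2) := by
      refine Real.le_sqrt_of_sq_le ?_
      exact Finset.single_le_sum (f := fun y => U y k ^ 2) (fun _ _ => sq_nonneg _) hx
    have h3 : Real.exp (α * L) * (Real.cosh (α * L))⁻¹ ≤ 2 := by
      have := mul_le_mul_of_nonneg_left (inv_cosh_le (α * L)) (Real.exp_pos (α * L)).le
      rwa [mul_left_comm, ← Real.exp_add, add_neg_cancel, Real.exp_zero, mul_one] at this
    refine h2.trans (h1.trans ?_)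
    have h4 : 0 ≤ √D.card * ε * Real.cosh (α * k) := by
      have := Real.cosh_pos (α * k); positivity
    calc _ = √D.card * ε * Real.cosh (α * k) *
          (Real.exp (α * L) * (Real.cosh (α * L))⁻¹) := by ring
      _ ≤ √D.card * ε * Real.cosh (α * k) * 2 := mul_le_mul_of_nonneg_left h3 h4
      _ = ε * A := by ring
  refine le_antisymm (le_of_forall_pos_le_add fun η hη => ?_) (hU0 x k)
  have h5 := hbound (η / (A + 1)) (by positivity)
  have h6 : η / (A + 1) * A ≤ η := by
    rw [div_mul_eq_mul_div, div_le_iff₀ (by positivity)]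
    nlinarith
  linarith

/-! ### The two estimates for harmonic functions. -/

theorem theorem5 (n : ℕ) (hn : 1 ≤ n) (Ω : Set (EuclideanSpace ℝ (Fin n)))
    (hΩ_open : IsOpen Ω) (hΩ_conn : IsConnected Ω) (hΩ_bdd : Bornology.IsBounded Ω)
    (hΩ_lip : HasLipschitzBoundary Ω) :
    (∃ C : ℝ, 0 < C ∧
      ∀ δ : ℝ, 0 < δ → IsDiscreteDomain (meshPoints δ Ω) →
      ∀ N : ℝ, 0 < N → (∃ L : ℕ, N = L * δ) →
      ∀ (h f : (Fin (n + 1) → ℤ) → ℝ) (M F : ℝ),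
        DiscreteHarmonicOn δ h (latticeSlab δ (meshPoints δ Ω) (Set.Ioo (-N) N)) →
        (∀ x ∈ latticeSlab δ (discreteBoundary (meshPoints δ Ω)) (Set.Icc (-N) N), h x = f x) →
        IsGreatest ((fun x => |f x|) ''
          latticeSlab δ (discreteBoundary (meshPoints δ Ω)) (Set.Icc (-N) N)) F →
        (∀ x ∈ latticeSlab δ (meshPoints δ Ω) {-N, N}, |h x| ≤ M) →
        ∀ x ∈ latticeSlab δ (discreteClosure (meshPoints δ Ω)) {0},
          |h x| ≤ F + C * (M + F) * Real.exp (-(growthExponent δ (meshPoints δ Ω) * N))) ∧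
    (∀ δ : ℝ, 0 < δ → IsDiscreteDomain (meshPoints δ Ω) →
      ∀ (h : (Fin (n + 1) → ℤ) → ℝ) (B : ℝ),
        DiscreteHarmonicOn δ h (latticeCylinder (meshPoints δ Ω)) →
        h =o[Filter.comap (fun x => |latticeHeight δ x|) Filter.atTop ⊓
            Filter.principal (latticeCylinder (meshPoints δ Ω))]
          (fun x => Real.exp (growthExponent δ (meshPoints δ Ω) * |latticeHeight δ x|)) →
        (∀ x ∈ latticeCylinder (discreteBoundary (meshPoints δ Ω)), |h x| ≤ B) →
        ∀ x ∈ latticeCylinder (discreteClosure (meshPoints δ Ω)), |h x| ≤ B) := by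
  constructor
  · obtain ⟨C, hC, hdecay⟩ := exists_exp_decay hΩ_open hΩ_conn.nonempty hΩ_bdd
    refine ⟨C, hC, ?_⟩
    rintro δ hδ ⟨hne, -⟩ _ hN ⟨L, rfl⟩ h f M F hharm hbd hF hM x ⟨hxD, hx0⟩
    obtain ⟨D, hDΩ, hD⟩ := hdecay δ hδ
    rw [← hDΩ] at hne hxD hbd hF
    rw [← hDΩ] at hharm hM hD ⊢
    have hDne : D.Nonempty := by exact_mod_cast hne
    have hF0 : 0 ≤ F := by
      obtain ⟨y, -, hy⟩ := hF.1
      exact hy ▸ abs_nonneg (f y)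
    have hbdF : ∀ k : ℤ, |k| ≤ (L : ℤ) → ∀ y ∈ discreteBoundary (D : Set (Fin n → ℤ)),
        |h (latticeLift y k)| ≤ F := by
      intro k hk y hy
      have hmem : latticeLift y k ∈ latticeSlab δ (discreteBoundary (D : Set (Fin n → ℤ)))
          (Set.Icc (-(L * δ)) (L * δ)) := by
        refine ⟨by simpa [latticeLift] using hy, ?_⟩
        have h1 : |(k : ℝ)| ≤ L := by exact_mod_cast hk
        rw [latticeHeight_latticeLift, Set.mem_Icc, ← abs_le, abs_mul, abs_of_pos hδ, mul_comm]
        gcongr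
      rw [hbd _ hmem]
      exact hF.2 ⟨_, hmem, rfl⟩
    have hcap : ∀ y ∈ D, ∀ k : ℤ, |k| = (L : ℤ) → |h (latticeLift y k)| ≤ M := by
      intro y hy k hk
      refine hM _ ⟨by simpa [latticeLift] using hy, ?_⟩
      rw [latticeHeight_latticeLift]
      rcases (abs_eq (by omega : (0 : ℤ) ≤ L)).1 hk with rfl | rfl
      · right; push_cast; exact mul_comm _ _
      · left; push_cast; ring
    have hM0 : 0 ≤ M := by
      obtain ⟨y, hy⟩ := hDne
      exact (abs_nonneg _).trans (hcap y hy L (by simp))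
    have hsub : ∀ y ∈ D, ∀ k : ℤ, |k| < (L : ℤ) →
        2 * (n + 1) * excess D h F y k ≤ neighborSum (fun z => excess D h F z k) y +
          (excess D h F y (k + 1) + excess D h F y (k - 1)) := by
      intro y hy k hk
      refine excess_subharmonic hδ hy (hharm _ ⟨by simpa [latticeLift] using hy, ?_⟩)
        (hbdF k hk.le)
      have h1 : |(k : ℝ)| < L := by exact_mod_cast hk
      rw [latticeHeight_latticeLift, Set.mem_Ioo, ← abs_lt, abs_mul, abs_of_pos hδ, mul_comm]
      gcongr
    have hx0' : x (Fin.last n) = 0 := by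
      have h1 : δ * (x (Fin.last n) : ℝ) = 0 := hx0
      exact_mod_cast (mul_eq_zero.1 h1).resolve_left hδ.ne'
    rw [← latticeLift_init x, hx0']
    have hE := Real.exp_pos (-(growthExponent δ (D : Set (Fin n → ℤ)) * (L * δ)))
    have hCF : 0 ≤ C * F * Real.exp (-(growthExponent δ (D : Set (Fin n → ℤ)) * (L * δ))) := by
      positivity
    have hCM : 0 ≤ C * M * Real.exp (-(growthExponent δ (D : Set (Fin n → ℤ)) * (L * δ))) := by
      positivity
    rcases hxD with hxD | hxD
    · have h1 := hD hDne L (excess D h F) M excess_nonneg (fun y hy => excess_of_notMem hy) hsub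
        hM0 (fun y hy k hk => excess_le hF0 hy (hcap y hy k hk)) (Fin.init x)
      rw [show δ * growthExponent δ (D : Set (Fin n → ℤ)) * L =
        growthExponent δ (D : Set (Fin n → ℤ)) * (L * δ) by ring] at h1
      have h2 := le_excess (h := h) (B := F) (show Fin.init x ∈ D from hxD) 0
      linarith
    · have h1 := hbdF 0 (by simp) _ hxD
      linarith
  · rintro δ hδ ⟨hne, -⟩ h B hharm hgrow hbd x hx
    obtain ⟨R, -, hmesh⟩ := exists_meshPoints_finset hΩ_bdd
    obtain ⟨D, hDΩ, -⟩ := hmesh δ hδ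
    rw [← hDΩ] at hne hx hbd
    rw [← hDΩ] at hharm hgrow
    have hDne : D.Nonempty := by exact_mod_cast hne
    have hbdB : ∀ k : ℤ, ∀ y ∈ discreteBoundary (D : Set (Fin n → ℤ)),
        |h (latticeLift y k)| ≤ B := fun k y hy =>
      hbd _ (by simpa [latticeLift, latticeCylinder] using hy)
    have hB0 : 0 ≤ B := by
      obtain ⟨y, hy⟩ := discreteBoundary_nonempty hn hDne
      exact (abs_nonneg _).trans (hbdB 0 y hy)
    have hxD : Fin.init x ∈ discreteClosure (D : Set (Fin n → ℤ)) := hx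
    rw [← latticeLift_init x]
    rcases hxD with hxD | hxD
    swap
    · exact hbdB _ _ hxD
    obtain ⟨α, hα, hαg, hvar⟩ := exists_growthExponent_eq hδ hDne
    have hzero := eq_zero_of_subharmonic_of_growth (U := excess D h B) hvar excess_nonneg
      (fun y hy => excess_of_notMem hy)
      (fun y hy k => excess_subharmonic hδ hy
        (hharm _ (by simpa [latticeLift, latticeCylinder] using hy)) (hbdB k)) ?_
      (Fin.init x) (x (Fin.last n))
    · have h1 := le_excess (h := h) (B := B) (show Fin.init x ∈ D from hxD) (x (Fin.last n))
      linarith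
    · intro ε hε
      have h1 := hgrow.bound hε
      rw [Filter.eventually_inf_principal, Filter.eventually_comap,
        Filter.eventually_atTop] at h1
      obtain ⟨a, ha⟩ := h1
      -- The little-o bound holds at physical height at least `a`, that is, from `a / δ` lattice
      -- steps on.
      refine ⟨⌈a / δ⌉₊, fun L hL y hy k hk => excess_le hB0 hy ?_⟩
      have hkL : |(k : ℝ)| = L := by exact_mod_cast hk
      have hht : |latticeHeight δ (latticeLift y k)| = δ * L := by
        rw [latticeHeight_latticeLift, abs_mul, abs_of_pos hδ, hkL]
      have hLa : a ≤ δ * L := by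
        have h2 : a / δ ≤ L := (Nat.le_ceil _).trans (by exact_mod_cast hL)
        rw [div_le_iff₀ hδ] at h2
        linarith
      have h3 := ha _ hLa _ hht (by simpa [latticeLift, latticeCylinder] using hy)
      rw [hht, Real.norm_eq_abs, Real.norm_eq_abs, abs_of_pos (Real.exp_pos _)] at h3
      rwa [show growthExponent δ (D : Set (Fin n → ℤ)) * (δ * L) = α * L by
        rw [← hαg]; ring] at h3
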